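/- All manifolds are smooth, finite-dimensional and without boundary. Let $G \rightrightarrows G_0$ be a Lie groupoid with source $s$, target $t$ and units $1_x$, where $gh$ is defined when $t(g)=s(h)$. Its Lie algebroid $A$ has fibres $A_x=\ker(s_*)\subset T_{1_x}G$ and anchor $\rho=t_*:A\to TG_0$. Let $P$ be a principal $G$-bundle over a manifold $M$: a surjective submersion $\pi:P\to M$ (for instance a smooth fibre bundle), a smooth map $\epsilon:P\to G_0$, and a smooth right action $\mu(p,g)=pg$, defined when $\epsilon(p)=s(g)$, with $\pi(pg)=\pi(p)$, $\epsilon(pg)=t(g)$, $p\,1_{\epsilon(p)}=p$ and $p(gh)=(pg)h$, such that $(p,g)\mapsto(p,pg)$ is a diffeomorphism $P\,{}_\epsilon\!\times_s G\to P\,{}_\pi\!\times_\pi P$. Let $\delta: P\,{}_\pi\!\times_\pi P\to G$ be the division map, $p\,\delta(p,q)=q$, and $\delta_p=\delta(p,\cdot):\pi^{-1}(\pi(p))\to s^{-1}(\epsilon(p))$. Let $H$ be a horizontal distribution on $P$, i.e. a smooth subbundle $H\subset TP$ with $TP=\ker\pi_*\oplus H$, and let $\mathrm{Ver}$ be the projection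 of $TP$ onto $\ker\pi_*$ along $H$. Its connection form $\alpha\in\Omega^1(P,\epsilon^*A)$ is $\alpha(X_p)=(\delta_p)_{*,p}\mathrm{Ver}(X_p)\in A_{\epsilon(p)}$ for $X_p\in T_pP$; regarded as a map $TP\to A$ over $\epsilon$ it is denoted $\alpha^\sharp$. The distribution $H$ is called a principal connection if $\epsilon_*H=0$ and $H_{pg}=(R_g)_*H_p$ for all $(p,g)\in P\,{}_\epsilon\!\times_s G$, where $(R_g)_*X=\mu_*(X,0_g)$ for $X\in T_pP$ with $\epsilon_*X=0$. A local bisection of $G$ is a smooth map $\gamma:U\to G$ on an open set $U\subset G_0$ such that $s\circ\gamma=\mathrm{id}_U$ and $t\circ\gamma$ is a diffeomorphism of $U$ onto an open subset of $G_0$. Let $R_\gamma(p)=p\,\gamma(\epsilon(p))$ for $p\in\epsilon^{-1}(U)$, and for $x\in U$ let $\mathrm{Ad}_{\gamma^{-1}}:A_x\to A_{t(\gamma(x))}$ be the derivative at $1_x$ of $g\mapsto\gamma(s(g))^{-1}\,g\,\gamma(t(g))$. **Proposition.** The map $\alpha^\sharp:TP\to A$ is a smooth vector bundle map over $\epsilon$,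 and: 1. $\epsilon_*H=0$ if and only if $\rho\circ\alpha^\sharp=\epsilon_*$. 2. $H$ is a principal connection if and only if $\rho\circ\alpha^\sharp=\epsilon_*$ and $\alpha$ is equivariant, i.e. $R_\gamma^*\alpha=\mathrm{Ad}_{\gamma^{-1}}\alpha$ on $\epsilon^{-1}(U)$ for every local bisection $\gamma:U\to G$ of $G$. -/

import Mathlib

open scoped Manifold ContDiff

noncomputable section

/-! Smooth maps on embedded submanifolds `S` of a manifold are described by total functions on the
ambient manifold, of which only the values on `S` matter; smoothness is `ContMDiffOn … ∞ f S`. The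
derivative `mfderivWithin … f S x` is then uniquely determined on vectors tangent to `S`, and it is
only ever used on such vectors. -/

/-- `f` restricts to a diffeomorphism from `S` to `T`. -/
def IsDiffeoOn {E E' X Y : Type*} [NormedAddCommGroup E] [NormedSpace ℝ E]
    [NormedAddCommGroup E'] [NormedSpace ℝ E'] {H H' : Type*} [TopologicalSpace H]
    [TopologicalSpace H'] (I : ModelWithCorners ℝ E H) (J : ModelWithCorners ℝ E' H')
    [TopologicalSpace X] [ChartedSpace H X] [TopologicalSpace Y] [ChartedSpace H' Y]
    (f : X → Y) (S : Set X) (T : Set Y) : Prop :=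
  Set.BijOn f S T ∧ ContMDiffOn I J ∞ f S ∧
    ∃ g : Y → X, Set.InvOn g f S T ∧ ContMDiffOn J I ∞ g T

/-- A Lie groupoid with arrow manifold `G` and object manifold `G₀`. The product `mul g h` is
meaningful when `tgt g = src h`; it is an arrow from `src g` to `tgt h`. -/
structure LieGroupoid (E₀ E₁ G₀ G : Type*)
    [NormedAddCommGroup E₀] [NormedSpace ℝ E₀] [NormedAddCommGroup E₁] [NormedSpace ℝ E₁]
    [TopologicalSpace G₀] [ChartedSpace E₀ G₀] [TopologicalSpace G] [ChartedSpace E₁ G] where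
  src : G → G₀
  tgt : G → G₀
  one : G₀ → G
  inv : G → G
  mul : G → G → G
  isSubmersion_src : Manifold.IsSubmersion 𝓘(ℝ, E₁) 𝓘(ℝ, E₀) ∞ src
  isSubmersion_tgt : Manifold.IsSubmersion 𝓘(ℝ, E₁) 𝓘(ℝ, E₀) ∞ tgt
  contMDiff_one : ContMDiff 𝓘(ℝ, E₀) 𝓘(ℝ, E₁) ∞ one
  contMDiff_inv : ContMDiff 𝓘(ℝ, E₁) 𝓘(ℝ, E₁) ∞ inv
  contMDiffOn_mul : ContMDiffOn (𝓘(ℝ, E₁).prod 𝓘(ℝ, E₁)) 𝓘(ℝ, E₁) ∞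
    (fun x : G × G => mul x.1 x.2) {x | tgt x.1 = src x.2}
  src_one : ∀ x, src (one x) = x
  tgt_one : ∀ x, tgt (one x) = x
  src_inv : ∀ g, src (inv g) = tgt g
  tgt_inv : ∀ g, tgt (inv g) = src g
  src_mul : ∀ g h, tgt g = src h → src (mul g h) = src g
  tgt_mul : ∀ g h, tgt g = src h → tgt (mul g h) = tgt h
  mul_assoc : ∀ g h k, tgt g = src h → tgt h = src k → mul (mul g h) k = mul g (mul h k)
  one_mul : ∀ g, mul (one (src g)) g = g
  mul_one : ∀ g, mul g (one (tgt g)) = g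
  mul_inv : ∀ g, mul g (inv g) = one (src g)
  inv_mul : ∀ g, mul (inv g) g = one (tgt g)

namespace LieGroupoid

variable {E₀ E₁ G₀ G : Type*}
    [NormedAddCommGroup E₀] [NormedSpace ℝ E₀] [NormedAddCommGroup E₁] [NormedSpace ℝ E₁]
    [TopologicalSpace G₀] [ChartedSpace E₀ G₀] [TopologicalSpace G] [ChartedSpace E₁ G]
    (𝓖 : LieGroupoid E₀ E₁ G₀ G)

/-- The fibre `A_x = ker s_*` (at the unit `1_x`) of the Lie algebroid. -/
def algebroid (x : G₀) : Submodule ℝ (TangentSpace 𝓘(ℝ, E₁) (𝓖.one x)) :=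
  (mfderiv 𝓘(ℝ, E₁) 𝓘(ℝ, E₀) 𝓖.src (𝓖.one x)).toLinearMap.ker

/-- The anchor `ρ = t_* : A_x → T_x G₀`; here `t (1_x) = x`. -/
def anchor (x : G₀) : 𝓖.algebroid x →ₗ[ℝ] TangentSpace 𝓘(ℝ, E₀) x :=
  (mfderiv 𝓘(ℝ, E₁) 𝓘(ℝ, E₀) 𝓖.tgt (𝓖.one x)).toLinearMap ∘ₗ (𝓖.algebroid x).subtype

/-- A local bisection: a smooth local section of the source map over an open set `U`, for which
`t ∘ γ` is a diffeomorphism from `U` onto an open subset of `G₀`. -/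
structure LocalBisection where
  U : Set G₀
  γ : G₀ → G
  isOpen_U : IsOpen U
  contMDiffOn : ContMDiffOn 𝓘(ℝ, E₀) 𝓘(ℝ, E₁) ∞ γ U
  src_γ : ∀ x ∈ U, 𝓖.src (γ x) = x
  injOn : Set.InjOn (𝓖.tgt ∘ γ) U
  isLocalDiffeomorphOn : IsLocalDiffeomorphOn 𝓘(ℝ, E₀) 𝓘(ℝ, E₀) ∞ (𝓖.tgt ∘ γ) U

/-- Conjugation by the inverse of a local bisection, `g ↦ γ(s g)⁻¹ g γ(t g)`, defined for arrows
`g` with source and target in the domain of `γ`. -/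
def conjInv (b : 𝓖.LocalBisection) (g : G) : G :=
  𝓖.mul (𝓖.mul (𝓖.inv (b.γ (𝓖.src g))) g) (b.γ (𝓖.tgt g))

/-- The adjoint action `Ad_{γ⁻¹} : A_x → T G` at `t (γ x)` of the inverse of a local bisection, for
`x` in the domain of `γ`; conjugation by `γ⁻¹` maps the unit at `x` to the unit at `t (γ x)`. -/
def AdInv (b : 𝓖.LocalBisection) (x : G₀) :
    𝓖.algebroid x →ₗ[ℝ] TangentSpace 𝓘(ℝ, E₁) (𝓖.one (𝓖.tgt (b.γ x))) :=
  (mfderiv 𝓘(ℝ, E₁) 𝓘(ℝ, E₁) (𝓖.conjInv b) (𝓖.one x)).toLinearMap ∘ₗ (𝓖.algebroid x).subtype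

end LieGroupoid

/-- A principal groupoid bundle `π : P → M` with structure Lie groupoid `𝓖`; the action `act p g` is
meaningful when `ε p = s g`. The projection `π` is a surjective submersion, as is that of every smooth
fibre bundle with nonempty fibres; no local triviality over `M` is required. -/
structure PrincipalGroupoidBundle {E₀ E₁ G₀ G : Type*}
    [NormedAddCommGroup E₀] [NormedSpace ℝ E₀] [NormedAddCommGroup E₁] [NormedSpace ℝ E₁]
    [TopologicalSpace G₀] [ChartedSpace E₀ G₀] [TopologicalSpace G] [ChartedSpace E₁ G]
    (𝓖 : LieGroupoid E₀ E₁ G₀ G) (EM EP M P : Type*)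
    [NormedAddCommGroup EM] [NormedSpace ℝ EM] [NormedAddCommGroup EP] [NormedSpace ℝ EP]
    [TopologicalSpace M] [ChartedSpace EM M] [TopologicalSpace P] [ChartedSpace EP P] where
  proj : P → M
  moment : P → G₀
  act : P → G → P
  surjective_proj : Function.Surjective proj
  isSubmersion_proj : Manifold.IsSubmersion 𝓘(ℝ, EP) 𝓘(ℝ, EM) ∞ proj
  contMDiff_moment : ContMDiff 𝓘(ℝ, EP) 𝓘(ℝ, E₀) ∞ moment
  contMDiffOn_act : ContMDiffOn (𝓘(ℝ, EP).prod 𝓘(ℝ, E₁)) 𝓘(ℝ, EP) ∞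
    (fun x : P × G => act x.1 x.2) {x | moment x.1 = 𝓖.src x.2}
  moment_act : ∀ p g, moment p = 𝓖.src g → moment (act p g) = 𝓖.tgt g
  act_one : ∀ p, act p (𝓖.one (moment p)) = p
  act_mul : ∀ p g h, moment p = 𝓖.src g → 𝓖.tgt g = 𝓖.src h →
    act p (𝓖.mul g h) = act (act p g) h
  proj_act : ∀ p g, moment p = 𝓖.src g → proj (act p g) = proj p
  isDiffeoOn : IsDiffeoOn (𝓘(ℝ, EP).prod 𝓘(ℝ, E₁)) (𝓘(ℝ, EP).prod 𝓘(ℝ, EP))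
    (fun x : P × G => (x.1, act x.1 x.2))
    {x | moment x.1 = 𝓖.src x.2} {y | proj y.1 = proj y.2}

/-- A family of subspaces `H p ⊆ T_p P` is a smooth subbundle of `TP`: around every point it is
framed by smooth vector fields. -/
def IsSmoothSubbundle {EP P : Type*} [NormedAddCommGroup EP] [NormedSpace ℝ EP]
    [TopologicalSpace P] [ChartedSpace EP P] [IsManifold 𝓘(ℝ, EP) ∞ P]
    (H : ∀ p : P, Submodule ℝ (TangentSpace 𝓘(ℝ, EP) p)) : Prop :=
  ∀ p : P, ∃ (U : Set P) (k : ℕ) (X : Fin k → ∀ q : P, TangentSpace 𝓘(ℝ, EP) q),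
    IsOpen U ∧ p ∈ U ∧
    (∀ i, ContMDiffOn 𝓘(ℝ, EP) 𝓘(ℝ, EP).tangent ∞
      (fun q => (⟨q, X i q⟩ : TangentBundle 𝓘(ℝ, EP) P)) U) ∧
    ∀ q ∈ U, LinearIndependent ℝ (fun i => X i q) ∧
      Submodule.span ℝ (Set.range fun i => X i q) = H q

/-- A vector in the kernel of the derivative of a submersion is the velocity of a curve in the
fibre. -/
theorem exists_curve_in_fibre {E F X Y : Type*}
    [NormedAddCommGroup E] [NormedSpace ℝ E] [NormedAddCommGroup F] [NormedSpace ℝ F]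
    [TopologicalSpace X] [ChartedSpace E X] [IsManifold 𝓘(ℝ, E) ∞ X]
    [TopologicalSpace Y] [ChartedSpace F Y] [IsManifold 𝓘(ℝ, F) ∞ Y]
    {f : X → Y} {x : X} (hf : Manifold.IsSubmersionAt 𝓘(ℝ, E) 𝓘(ℝ, F) ∞ f x)
    (v : TangentSpace 𝓘(ℝ, E) x) (hv : mfderiv 𝓘(ℝ, E) 𝓘(ℝ, F) f x v = 0) :
    ∃ c : ℝ → X, c 0 = x ∧ (∀ᶠ τ in nhds 0, f (c τ) = f x) ∧
      HasMFDerivAt 𝓘(ℝ, ℝ) 𝓘(ℝ, E) c 0 (ContinuousLinearMap.toSpanSingleton ℝ (v : E)) := by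
  have hn : (∞ : WithTop ℕ∞) ≠ 0 := by simp
  obtain ⟨φ, hφ⟩ : ∃ φ, φ = hf.domChart := ⟨_, rfl⟩
  obtain ⟨ψ, hψ⟩ : ∃ ψ, ψ = hf.codChart := ⟨_, rfl⟩
  have hxφ : x ∈ φ.source := hφ ▸ hf.mem_domChart_source
  have hxψ : f x ∈ ψ.source := hψ ▸ hf.mem_codChart_source
  have hsub : φ.source ⊆ f ⁻¹' ψ.source := by
    rw [hφ, hψ]; exact hf.source_subset_preimage_source
  have hφm : φ ∈ IsManifold.maximalAtlas 𝓘(ℝ, E) ∞ X := hφ ▸ hf.domChart_mem_maximalAtlas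
  have hψm : ψ ∈ IsManifold.maximalAtlas 𝓘(ℝ, F) ∞ Y := hψ ▸ hf.codChart_mem_maximalAtlas
  have hw := hf.writtenInCharts
  rw [← hφ, ← hψ] at hw
  set e := hf.equiv
  have key : ∀ y ∈ φ.target, ψ (f (φ.symm y)) = (e y).1 := by
    intro y hy
    have := hw (x := y) (by simpa using hy)
    simpa using this
  have key' : ∀ z ∈ φ.source, ψ (f z) = (e (φ z)).1 := by
    intro z hz
    simpa [φ.left_inv hz] using key (φ z) (φ.map_source hz)
  have dφ : φ.MDifferentiable 𝓘(ℝ, E) 𝓘(ℝ, E) :=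
    ⟨(contMDiffOn_of_mem_maximalAtlas hφm).mdifferentiableOn hn,
      (contMDiffOn_symm_of_mem_maximalAtlas hφm).mdifferentiableOn hn⟩
  have dψ : ψ.MDifferentiable 𝓘(ℝ, F) 𝓘(ℝ, F) :=
    ⟨(contMDiffOn_of_mem_maximalAtlas hψm).mdifferentiableOn hn,
      (contMDiffOn_symm_of_mem_maximalAtlas hψm).mdifferentiableOn hn⟩
  have df : MDifferentiableAt 𝓘(ℝ, E) 𝓘(ℝ, F) f x := hf.contMDiffAt.mdifferentiableAt hn
  obtain ⟨w, hwdef⟩ : ∃ w : E, w = mfderiv 𝓘(ℝ, E) 𝓘(ℝ, E) φ x v := ⟨_, rfl⟩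
  have hew : (e w).1 = 0 := by
    let L := (ContinuousLinearMap.fst ℝ F hf.complement).comp (e : E →L[ℝ] F × hf.complement)
    have a1 : HasMFDerivAt 𝓘(ℝ, E) 𝓘(ℝ, F) (ψ ∘ f) x
        ((mfderiv 𝓘(ℝ, F) 𝓘(ℝ, F) ψ (f x)).comp (mfderiv 𝓘(ℝ, E) 𝓘(ℝ, F) f x)) :=
      HasMFDerivAt.comp x (dψ.mdifferentiableAt hxψ).hasMFDerivAt df.hasMFDerivAt
    have a2 : HasMFDerivAt 𝓘(ℝ, E) 𝓘(ℝ, F) (L ∘ φ) x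
        (L.comp (mfderiv 𝓘(ℝ, E) 𝓘(ℝ, E) φ x)) :=
      HasMFDerivAt.comp x (L.hasMFDerivAt) (dφ.mdifferentiableAt hxφ).hasMFDerivAt
    have a3 : (ψ ∘ f) =ᶠ[nhds x] (L ∘ φ) := by
      filter_upwards [φ.open_source.mem_nhds hxφ] with z hz
      exact key' z hz
    have a4 := hasMFDerivAt_unique a1 (a2.congr_of_eventuallyEq a3)
    have a5 := congrArg (fun T => T v) a4
    have a6 : mfderiv 𝓘(ℝ, F) 𝓘(ℝ, F) ψ (f x) (mfderiv 𝓘(ℝ, E) 𝓘(ℝ, F) f x v) = (e w).1 := by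
      rw [hwdef]; exact a5
    rw [← a6, hv, map_zero]
    rfl
  have hcont : Continuous fun τ : ℝ => φ x + τ • w := by fun_prop
  have hev : ∀ᶠ τ : ℝ in nhds 0, φ x + τ • w ∈ φ.target := by
    apply hcont.continuousAt.preimage_mem_nhds
    simpa using φ.open_target.mem_nhds (φ.map_source hxφ)
  refine ⟨fun τ => φ.symm (φ x + τ • w), by simp [φ.left_inv hxφ], ?_, ?_⟩
  · filter_upwards [hev] with τ hτ
    apply ψ.injOn (hsub (φ.map_target hτ)) hxψ
    rw [key _ hτ, key' x hxφ]
    simp [hew]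
  · have b1 : HasMFDerivAt 𝓘(ℝ, ℝ) 𝓘(ℝ, E) (fun τ : ℝ => φ x + τ • w) 0
        (ContinuousLinearMap.toSpanSingleton ℝ w) := by
      apply HasFDerivAt.hasMFDerivAt
      exact ((ContinuousLinearMap.toSpanSingleton ℝ w).hasFDerivAt (x := (0 : ℝ))).const_add (φ x)
    have b2 : HasMFDerivAt 𝓘(ℝ, E) 𝓘(ℝ, E) φ.symm (φ x + (0 : ℝ) • w)
        (mfderiv 𝓘(ℝ, E) 𝓘(ℝ, E) φ.symm (φ x)) := by
      rw [zero_smul, add_zero]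
      exact (dφ.mdifferentiableAt_symm (φ.map_source hxφ)).hasMFDerivAt
    have b3 := HasMFDerivAt.comp (0 : ℝ) b2 b1
    have b4 := congrArg (fun T => T v) (dφ.symm_comp_deriv hxφ)
    have b5 : mfderiv 𝓘(ℝ, E) 𝓘(ℝ, E) φ.symm (φ x) w = v := by rw [hwdef]; exact b4
    have b6 : (mfderiv 𝓘(ℝ, E) 𝓘(ℝ, E) φ.symm (φ x) : E →L[ℝ] E).comp
        (ContinuousLinearMap.toSpanSingleton ℝ w) =
        ContinuousLinearMap.toSpanSingleton ℝ (v : E) := by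
      refine ContinuousLinearMap.ext fun t => ?_
      change mfderiv 𝓘(ℝ, E) 𝓘(ℝ, E) φ.symm (φ x) (t • w) = t • v
      exact (map_smul (mfderiv 𝓘(ℝ, E) 𝓘(ℝ, E) φ.symm (φ x) : E →L[ℝ] E) t w).trans
        (congrArg (t • ·) b5)
    exact b6 ▸ b3

/-- If `k ∘ g` is constant on a fibre of a submersion, then the derivative of `k` kills the image
under the derivative of `g` along the fibre of each vector tangent to the fibre. -/
theorem mfderiv_mfderivWithin_fibre_eq_zero {E F E' F' X Y Z W : Type*}
    [NormedAddCommGroup E] [NormedSpace ℝ E] [NormedAddCommGroup F] [NormedSpace ℝ F]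
    [NormedAddCommGroup E'] [NormedSpace ℝ E'] [NormedAddCommGroup F'] [NormedSpace ℝ F']
    [TopologicalSpace X] [ChartedSpace E X] [IsManifold 𝓘(ℝ, E) ∞ X]
    [TopologicalSpace Y] [ChartedSpace F Y] [IsManifold 𝓘(ℝ, F) ∞ Y]
    [TopologicalSpace Z] [ChartedSpace E' Z] [TopologicalSpace W] [ChartedSpace F' W]
    {f : X → Y} {x : X} (hf : Manifold.IsSubmersionAt 𝓘(ℝ, E) 𝓘(ℝ, F) ∞ f x)
    {g : X → Z} {k : Z → W} {z : Z} (hz : g x = z)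
    (hk : MDifferentiableAt 𝓘(ℝ, E') 𝓘(ℝ, F') k z)
    (hkg : ∀ q, f q = f x → k (g q) = k z)
    (v : TangentSpace 𝓘(ℝ, E) x) (hv : mfderiv 𝓘(ℝ, E) 𝓘(ℝ, F) f x v = 0) :
    mfderiv 𝓘(ℝ, E') 𝓘(ℝ, F') k z
      (mfderivWithin 𝓘(ℝ, E) 𝓘(ℝ, E') g {q | f q = f x} x v : E') = 0 := by
  subst hz
  by_cases hg : MDifferentiableWithinAt 𝓘(ℝ, E) 𝓘(ℝ, E') g {q | f q = f x} x
  · obtain ⟨c, hc0, hcf, hc⟩ := exists_curve_in_fibre hf v hv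
    subst hc0
    have a1 := hg.hasMFDerivWithinAt.comp (0 : ℝ) (hc.hasMFDerivWithinAt (s := c ⁻¹' _))
      (Set.Subset.refl _)
    have a2 := a1.hasMFDerivAt hcf
    have a3 := HasMFDerivAt.comp (0 : ℝ) hk.hasMFDerivAt a2
    have a4 : HasMFDerivAt 𝓘(ℝ, ℝ) 𝓘(ℝ, F') (k ∘ g ∘ c) 0
        (0 : ℝ →L[ℝ] F') :=
      (hasMFDerivAt_const (k (g (c 0))) (0 : ℝ)).congr_of_eventuallyEq
        (by filter_upwards [hcf] with τ hτ using hkg _ hτ)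
    have a5 := congrArg (fun T => T (1 : ℝ)) (hasMFDerivAt_unique a3 a4)
    have a6 : mfderiv 𝓘(ℝ, E') 𝓘(ℝ, F') k (g (c 0))
      (mfderivWithin 𝓘(ℝ, E) 𝓘(ℝ, E') g {q | f q = f (c 0)} (c 0) ((1 : ℝ) • v)) = 0 := a5
    rwa [one_smul] at a6
  · rw [mfderivWithin_zero_of_not_mdifferentiableWithinAt hg]
    exact map_zero _

namespace PrincipalGroupoidBundle

variable {E₀ E₁ G₀ G : Type*}
    [NormedAddCommGroup E₀] [NormedSpace ℝ E₀] [NormedAddCommGroup E₁] [NormedSpace ℝ E₁]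
    [TopologicalSpace G₀] [ChartedSpace E₀ G₀] [TopologicalSpace G] [ChartedSpace E₁ G]
    {𝓖 : LieGroupoid E₀ E₁ G₀ G} {EM EP M P : Type*}
    [NormedAddCommGroup EM] [NormedSpace ℝ EM] [NormedAddCommGroup EP] [NormedSpace ℝ EP]
    [TopologicalSpace M] [ChartedSpace EM M] [TopologicalSpace P] [ChartedSpace EP P]
    (𝓟 : PrincipalGroupoidBundle 𝓖 EM EP M P)

/-- The division map `δ`: for `π p = π q`, the second component of the preimage of `(p, q)` under
`(p, g) ↦ (p, p g)`. -/
def div (p q : P) : G :=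
  haveI : Nonempty (P × G) := ⟨(p, 𝓖.one (𝓟.moment p))⟩
  (Function.invFunOn (fun x : P × G => (x.1, 𝓟.act x.1 x.2))
    {x | 𝓟.moment x.1 = 𝓖.src x.2} (p, q)).2

theorem div_spec {p q : P} (h : 𝓟.proj q = 𝓟.proj p) :
    𝓟.moment p = 𝓖.src (𝓟.div p q) ∧ 𝓟.act p (𝓟.div p q) = q := by
  have : Nonempty (P × G) := ⟨(p, 𝓖.one (𝓟.moment p))⟩
  have hex := 𝓟.isDiffeoOn.1.surjOn (show (p, q) ∈ {y : P × P | 𝓟.proj y.1 = 𝓟.proj y.2} from h.symm)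
  have h1 := Function.invFunOn_mem hex
  have h2 := Function.invFunOn_eq hex
  have h3 := congrArg Prod.fst h2
  have h4 := congrArg Prod.snd h2
  simp only at h3 h4
  simp only [Set.mem_ofPred_eq] at h1
  rw [h3] at h1 h4
  exact ⟨h1, h4⟩

theorem div_self (p : P) : 𝓟.div p p = 𝓖.one (𝓟.moment p) := by
  obtain ⟨h1, h2⟩ := 𝓟.div_spec (rfl : 𝓟.proj p = 𝓟.proj p)
  have := 𝓟.isDiffeoOn.1.injOn (x₁ := (p, 𝓟.div p p)) (x₂ := (p, 𝓖.one (𝓟.moment p))) h1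
    (by simp [𝓖.src_one]) (by simp [h2, 𝓟.act_one])
  exact congrArg Prod.snd this

/-- The vertical space `ker π_*` at `p`. -/
def vertical (p : P) : Submodule ℝ (TangentSpace 𝓘(ℝ, EP) p) :=
  (mfderiv 𝓘(ℝ, EP) 𝓘(ℝ, EM) 𝓟.proj p).toLinearMap.ker

/-- The derivative at `p` of `δ_p = δ(p, ·)` on the fibre of `π` through `p`, as a linear map
`ker π_* → A_{ε p}`. -/
def divDeriv [IsManifold 𝓘(ℝ, EP) ∞ P] [IsManifold 𝓘(ℝ, EM) ∞ M] (p : P) :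
    𝓟.vertical p →ₗ[ℝ] 𝓖.algebroid (𝓟.moment p) where
  toFun v := ⟨(mfderivWithin 𝓘(ℝ, EP) 𝓘(ℝ, E₁) (𝓟.div p) {q | 𝓟.proj q = 𝓟.proj p} p v.1 : E₁),
    mfderiv_mfderivWithin_fibre_eq_zero (𝓟.isSubmersion_proj.isSubmersionAt p) (𝓟.div_self p)
      ((𝓖.isSubmersion_src.isSubmersionAt _).contMDiffAt.mdifferentiableAt (by simp))
      (fun q hq => by rw [← (𝓟.div_spec hq).1, 𝓖.src_one]) v.1 v.2⟩
  map_add' v w := Subtype.ext (map_add _ v.1 w.1)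
  map_smul' r v := Subtype.ext (map_smul _ r v.1)

/-- The pairs `(p, g)` for which `p g` is defined. -/
def composable : Set (P × G) := {x | 𝓟.moment x.1 = 𝓖.src x.2}

/-- The tangent action `(R_g)_* X = μ_* (X, 0_g)`, meaningful for `ε p = s g` and `ε_* X = 0`, that
is, when `(X, 0_g)` is tangent to the fibre product on which the action `μ` is defined. -/
def tangentAct (p : P) (g : G) :
    TangentSpace 𝓘(ℝ, EP) p →ₗ[ℝ] TangentSpace 𝓘(ℝ, EP) (𝓟.act p g) :=
  (mfderivWithin (𝓘(ℝ, EP).prod 𝓘(ℝ, E₁)) 𝓘(ℝ, EP) (fun x : P × G => 𝓟.act x.1 x.2)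
    𝓟.composable (p, g)).toLinearMap ∘ₗ
      LinearMap.inl ℝ (TangentSpace 𝓘(ℝ, EP) p) (TangentSpace 𝓘(ℝ, E₁) g)

/-- The right translation `R_γ : p ↦ p γ(ε p)`, defined on the preimage under `ε` of the domain of
the local bisection `γ`. -/
def rightTranslation (b : 𝓖.LocalBisection) (p : P) : P := 𝓟.act p (b.γ (𝓟.moment p))

/-- A horizontal distribution: a smooth subbundle `H` of `TP` with `TP = ker π_* ⊕ H`. -/
structure HorizontalDistribution [IsManifold 𝓘(ℝ, EP) ∞ P] where
  H : ∀ p : P, Submodule ℝ (TangentSpace 𝓘(ℝ, EP) p)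
  isSmoothSubbundle : IsSmoothSubbundle H
  isCompl : ∀ p, IsCompl (𝓟.vertical p) (H p)

namespace HorizontalDistribution

variable [IsManifold 𝓘(ℝ, EP) ∞ P] {𝓟} (𝓗 : 𝓟.HorizontalDistribution)

/-- The projection of `T_p P` onto `ker π_*` along `H_p`. -/
def ver (p : P) : TangentSpace 𝓘(ℝ, EP) p →ₗ[ℝ] 𝓟.vertical p :=
  (𝓟.vertical p).projectionOnto (𝓗.H p) (𝓗.isCompl p)

/-- The connection form `α(X_p) = (δ_p)_* Ver(X_p) ∈ A_{ε p}`, or equivalently the map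
`α♯ : TP → A` over `ε`. -/
def connectionForm [IsManifold 𝓘(ℝ, EM) ∞ M] (p : P) :
    TangentSpace 𝓘(ℝ, EP) p →ₗ[ℝ] 𝓖.algebroid (𝓟.moment p) :=
  𝓟.divDeriv p ∘ₗ 𝓗.ver p

/-- The condition `ε_* H = 0`. -/
def MomentCondition : Prop :=
  ∀ p, ∀ X ∈ 𝓗.H p, mfderiv 𝓘(ℝ, EP) 𝓘(ℝ, E₀) 𝓟.moment p X = 0

/-- A principal connection: `ε_* H = 0` and `H_{p g} = (R_g)_* H_p`. -/
def IsPrincipalConnection : Prop :=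
  𝓗.MomentCondition ∧
    ∀ p g, 𝓟.moment p = 𝓖.src g → 𝓗.H (𝓟.act p g) = (𝓗.H p).map (𝓟.tangentAct p g)

end HorizontalDistribution

/-- A family of linear maps `a_p : T_p P → A_{ε p}` is a smooth bundle map `TP → A` over `ε`; the
smooth structure of `A` is that of a submanifold of `TG`. -/
def IsSmoothBundleMap [IsManifold 𝓘(ℝ, EP) ∞ P] [IsManifold 𝓘(ℝ, E₁) ∞ G]
    (a : ∀ p : P, TangentSpace 𝓘(ℝ, EP) p →ₗ[ℝ] 𝓖.algebroid (𝓟.moment p)) : Prop :=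
  ContMDiff 𝓘(ℝ, EP).tangent 𝓘(ℝ, E₁).tangent ∞
    (fun v : TangentBundle 𝓘(ℝ, EP) P =>
      (⟨𝓖.one (𝓟.moment v.proj), (a v.proj v.snd).1⟩ : TangentBundle 𝓘(ℝ, E₁) G))

/-- The anchor condition `ρ ∘ α♯ = ε_*`. -/
def AnchorCondition
    (a : ∀ p : P, TangentSpace 𝓘(ℝ, EP) p →ₗ[ℝ] 𝓖.algebroid (𝓟.moment p)) : Prop :=
  ∀ (p : P) (X : TangentSpace 𝓘(ℝ, EP) p),
    𝓖.anchor (𝓟.moment p) (a p X) = mfderiv 𝓘(ℝ, EP) 𝓘(ℝ, E₀) 𝓟.moment p X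

/-- Equivariance `R_γ^* α = Ad_{γ⁻¹} α` for all local bisections `γ`. At a point `p` with `ε p` in
the domain of `γ`, both sides take values in `A` at `ε (p γ(ε p)) = t (γ(ε p))`. -/
def IsEquivariant
    (a : ∀ p : P, TangentSpace 𝓘(ℝ, EP) p →ₗ[ℝ] 𝓖.algebroid (𝓟.moment p)) : Prop :=
  ∀ (b : 𝓖.LocalBisection) (p : P), 𝓟.moment p ∈ b.U → ∀ X : TangentSpace 𝓘(ℝ, EP) p,
    ((a (𝓟.rightTranslation b p)
      (mfderiv 𝓘(ℝ, EP) 𝓘(ℝ, EP) (𝓟.rightTranslation b) p X)).1 : E₁) =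
    (𝓖.AdInv b (𝓟.moment p) (a p X) : E₁)

end PrincipalGroupoidBundle

end

/-!
The division map satisfies `t (δ(p, q)) = ε(q)`, `p δ(p, q) = q` on each fibre of `π`, and
`δ(p γ, q γ) = γ⁻¹ δ(p, q) γ` for a local bisection `γ`. Differentiating these three identities in
`q` along curves in the fibre through `p` shows that on *vertical* vectors the anchor condition
holds (`anchor_divDeriv`), that `(δ_p)_*` is injective (`divDeriv_eq_zero_iff`), and that
equivariance holds (`divDeriv_mfderiv_rightTranslation`), whatever `H` is. Hence `H = ker α`, and
both conditions on `α` only need to be examined on horizontal vectors. There the anchor condition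
says `ε_* H = 0`, and equivariance says that `(R_γ)_*` maps `H` into `H` (`isEquivariant_iff`).

If `ε_* X = 0`, then `(R_γ)_* X` only depends on the value `g = γ(ε p)` and equals `(R_g)_* X`
(`mfderiv_rightTranslation_eq_tangentAct`). So a principal connection is equivariant; conversely,
since every arrow lies on a local bisection (`LieGroupoid.exists_localBisection`), equivariance gives
`(R_g)_* H_p ⊆ H_{p g}`, and equality follows because `R_γ` covers the identity of `M` and a
horizontal vector is determined by its projection to `M`. The bisection through `g` is a local
section of `s` whose tangent space at `g` is transverse to both `ker s_*` and `ker t_*`; such a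
subspace exists because the two kernels have the same dimension, and the inverse function theorem
does the rest.

For the smoothness of `α♯`, the derivatives `(δ_p)_*` are extended from the vertical bundle to a
smooth map on `TP`, by composing `δ` with a smooth family of local retractions onto the fibres of `π`
(`exists_smooth_extension_divDeriv`). It remains to compose this extension with the projection onto
the vertical bundle, which is smooth by a computation in a local frame of `H`
(`HorizontalDistribution.contMDiff_ver`).
-/

/-! ### Submersions in adapted charts -/

section Submersion

open Manifold

variable {E F X Y : Type*}
    [NormedAddCommGroup E] [NormedSpace ℝ E] [NormedAddCommGroup F] [NormedSpace ℝ F]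
    [TopologicalSpace X] [ChartedSpace E X] [TopologicalSpace Y] [ChartedSpace F Y]

/-- In suitable local coordinates a submersion is the first projection of a product. -/
theorem Manifold.IsSubmersionAt.exists_product_coordinates
    [IsManifold 𝓘(ℝ, E) ∞ X] [IsManifold 𝓘(ℝ, F) ∞ Y] {f : X → Y} {x : X}
    (hf : IsSubmersionAt 𝓘(ℝ, E) 𝓘(ℝ, F) ∞ f x) :
    ∃ (Θ : PartialDiffeomorph 𝓘(ℝ, E) 𝓘(ℝ, F × hf.complement) X (F × hf.complement) ∞)
      (Ψ : PartialDiffeomorph 𝓘(ℝ, F) 𝓘(ℝ, F) Y F ∞),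
      x ∈ Θ.source ∧ Set.MapsTo f Θ.source Ψ.source ∧ ∀ z ∈ Θ.source, Ψ (f z) = (Θ z).1 := by
  let φ : PartialDiffeomorph 𝓘(ℝ, E) 𝓘(ℝ, E) X E ∞ :=
    { hf.domChart with
      contMDiffOn_toFun := contMDiffOn_of_mem_maximalAtlas hf.domChart_mem_maximalAtlas
      contMDiffOn_invFun := contMDiffOn_symm_of_mem_maximalAtlas hf.domChart_mem_maximalAtlas }
  let Ψ : PartialDiffeomorph 𝓘(ℝ, F) 𝓘(ℝ, F) Y F ∞ :=
    { hf.codChart with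
      contMDiffOn_toFun := contMDiffOn_of_mem_maximalAtlas hf.codChart_mem_maximalAtlas
      contMDiffOn_invFun := contMDiffOn_symm_of_mem_maximalAtlas hf.codChart_mem_maximalAtlas }
  have hs : (φ.trans hf.equiv.toDiffeomorph.toPartialDiffeomorph).source = hf.domChart.source := by
    change hf.domChart.source ∩ hf.domChart ⁻¹' Set.univ = _
    simp
  refine ⟨φ.trans hf.equiv.toDiffeomorph.toPartialDiffeomorph, Ψ, ?_, ?_, ?_⟩
  · rw [hs]; exact hf.mem_domChart_source
  · rw [hs]; exact hf.source_subset_preimage_source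
  · rw [hs]
    intro z hz
    have hz' : hf.domChart z ∈ (hf.domChart.extend 𝓘(ℝ, E)).target := by
      simpa using hf.domChart.map_source hz
    have h := hf.writtenInCharts hz'
    change hf.codChart (f z) = (hf.equiv (hf.domChart z)).1
    simpa [hf.domChart.left_inv hz] using h

/-- A map that is the first projection in local coordinates `Θ` and `Ψ` has smooth local sections
through every point of the domain of `Θ`, of arbitrary slope `N` in these coordinates. -/
theorem PartialDiffeomorph.exists_section {C : Type*} [NormedAddCommGroup C] [NormedSpace ℝ C]
    {f : X → Y} {x : X}
    (Θ : PartialDiffeomorph 𝓘(ℝ, E) 𝓘(ℝ, F × C) X (F × C) ∞)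
    (Ψ : PartialDiffeomorph 𝓘(ℝ, F) 𝓘(ℝ, F) Y F ∞)
    (hx : x ∈ Θ.source) (hf : Set.MapsTo f Θ.source Ψ.source)
    (h : ∀ z ∈ Θ.source, Ψ (f z) = (Θ z).1) (N : F →L[ℝ] C) :
    ∃ (U : Set Y) (σ : Y → X), IsOpen U ∧ f x ∈ U ∧ ContMDiffOn 𝓘(ℝ, F) 𝓘(ℝ, E) ∞ σ U ∧
      σ (f x) = x ∧ (∀ y ∈ U, f (σ y) = y) ∧
      HasMFDerivAt 𝓘(ℝ, F) 𝓘(ℝ, E) σ (f x)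
        ((mfderiv 𝓘(ℝ, F × C) 𝓘(ℝ, E) Θ.symm (Θ x) : F × C →L[ℝ] E).comp
          (((ContinuousLinearMap.id ℝ F).prod N).comp
            (mfderiv 𝓘(ℝ, F) 𝓘(ℝ, F) Ψ (f x) : F →L[ℝ] F))) := by
  have hn : (∞ : WithTop ℕ∞) ≠ 0 := by simp
  let j : F → F × C := fun u => (u, (Θ x).2 + N (u - Ψ (f x)))
  have hj : ContDiff ℝ ∞ j := by fun_prop
  have hjd : HasFDerivAt j ((ContinuousLinearMap.id ℝ F).prod N) (Ψ (f x)) := by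
    refine (hasFDerivAt_id _).prodMk ?_
    exact (N.hasFDerivAt.comp _ ((hasFDerivAt_id _).sub_const _)).const_add _
  have hjx : j (Ψ (f x)) = Θ x := by
    apply Prod.ext
    · exact h x hx
    · simp [j]
  have hΘx : Θ x ∈ Θ.target := Θ.map_source hx
  have hU : IsOpen (Ψ.source ∩ Ψ ⁻¹' (j ⁻¹' Θ.target)) :=
    Ψ.contMDiffOn.continuousOn.isOpen_inter_preimage Ψ.open_source
      (Θ.open_target.preimage hj.continuous)
  refine ⟨Ψ.source ∩ Ψ ⁻¹' (j ⁻¹' Θ.target), fun y => Θ.symm (j (Ψ y)), hU, ⟨hf hx, ?_⟩, ?_, ?_, ?_,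
    ?_⟩
  · change j (Ψ (f x)) ∈ Θ.target
    rwa [hjx]
  · refine Θ.symm.contMDiffOn.comp (t := Θ.target) (hj.contMDiff.comp_contMDiffOn
      (Ψ.contMDiffOn.mono Set.inter_subset_left)) fun y hy => hy.2
  · change Θ.symm (j (Ψ (f x))) = x
    rw [hjx]
    exact Θ.left_inv hx
  · intro y hy
    have hy' : Θ.symm (j (Ψ y)) ∈ Θ.source := Θ.map_target hy.2
    apply Ψ.injOn (hf hy') hy.1
    have h1 := h _ hy'
    have h2 : Θ (Θ.symm (j (Ψ y))) = j (Ψ y) := Θ.right_inv hy.2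
    rw [h2] at h1
    exact h1
  · have d1 := (Ψ.mdifferentiableAt hn (hf hx)).hasMFDerivAt
    have d2 := HasMFDerivAt.comp (f x) hjd.hasMFDerivAt d1
    have d3 := (Θ.symm.mdifferentiableAt hn hΘx).hasMFDerivAt
    rw [← hjx] at d3
    have d4 := HasMFDerivAt.comp (f x) d3 d2
    rw [hjx] at d4
    exact d4

theorem Manifold.IsSubmersionAt.mfderiv_surjective
    [IsManifold 𝓘(ℝ, E) ∞ X] [IsManifold 𝓘(ℝ, F) ∞ Y] {f : X → Y} {x : X}
    (hf : IsSubmersionAt 𝓘(ℝ, E) 𝓘(ℝ, F) ∞ f x) :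
    Function.Surjective (mfderiv 𝓘(ℝ, E) 𝓘(ℝ, F) f x) := by
  obtain ⟨Θ, Ψ, hx, hfm, h⟩ := hf.exists_product_coordinates
  obtain ⟨U, σ, hU, hxU, -, hσx, hσ, hd⟩ := Θ.exists_section Ψ hx hfm h 0
  have d1 := (hf.contMDiffAt.mdifferentiableAt (by simp)).hasMFDerivAt
  rw [← hσx] at d1
  have d2 := HasMFDerivAt.comp (f x) d1 hd
  have d3 : HasMFDerivAt 𝓘(ℝ, F) 𝓘(ℝ, F) (f ∘ σ) (f x) (ContinuousLinearMap.id ℝ F) :=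
    (hasMFDerivAt_id (f x)).congr_of_eventuallyEq
      (by filter_upwards [hU.mem_nhds hxU] with y hy using hσ y hy)
  have d4 := hasMFDerivAt_unique d2 d3
  rw [hσx] at d4
  intro w
  exact ⟨_, congrArg (fun T => T w) d4⟩

/-- A submersion admits local retractions `r (p, ·)` onto the fibre through `p`, smooth jointly in
both variables. -/
theorem Manifold.IsSubmersionAt.exists_fibre_retraction
    [IsManifold 𝓘(ℝ, E) ∞ X] [IsManifold 𝓘(ℝ, F) ∞ Y] {f : X → Y} {x : X}
    (hf : IsSubmersionAt 𝓘(ℝ, E) 𝓘(ℝ, F) ∞ f x) :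
    ∃ (W : Set (X × X)) (r : X × X → X), IsOpen W ∧ (x, x) ∈ W ∧
      ContMDiffOn (𝓘(ℝ, E).prod 𝓘(ℝ, E)) 𝓘(ℝ, E) ∞ r W ∧
      (∀ y ∈ W, f (r y) = f y.1) ∧ ∀ y ∈ W, f y.2 = f y.1 → r y = y.2 := by
  obtain ⟨Θ, Ψ, hx, hfm, h⟩ := hf.exists_product_coordinates
  let j : X × X → F × hf.complement := fun y => ((Θ y.1).1, (Θ y.2).2)
  have hj : ContMDiffOn (𝓘(ℝ, E).prod 𝓘(ℝ, E)) 𝓘(ℝ, F × hf.complement) ∞ j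
      (Θ.source ×ˢ Θ.source) := by
    have h1 : ContMDiffOn (𝓘(ℝ, E).prod 𝓘(ℝ, E)) 𝓘(ℝ, F × hf.complement) ∞
        (fun y : X × X => Θ y.1) (Θ.source ×ˢ Θ.source) :=
      Θ.contMDiffOn.comp contMDiffOn_fst fun y hy => hy.1
    have h2 : ContMDiffOn (𝓘(ℝ, E).prod 𝓘(ℝ, E)) 𝓘(ℝ, F × hf.complement) ∞
        (fun y : X × X => Θ y.2) (Θ.source ×ˢ Θ.source) :=
      Θ.contMDiffOn.comp contMDiffOn_snd fun y hy => hy.2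
    exact (contDiff_fst.contMDiff.comp_contMDiffOn h1).prodMk_space
      (contDiff_snd.contMDiff.comp_contMDiffOn h2)
  have hjeq : ∀ y ∈ Θ.source ×ˢ Θ.source, f y.2 = f y.1 → j y = Θ y.2 := by
    intro y hy hfy
    apply Prod.ext
    · change (Θ y.1).1 = (Θ y.2).1
      rw [← h _ hy.1, ← h _ hy.2, hfy]
    · rfl
  refine ⟨(Θ.source ×ˢ Θ.source) ∩ j ⁻¹' Θ.target, fun y => Θ.symm (j y),
    hj.continuousOn.isOpen_inter_preimage (Θ.open_source.prod Θ.open_source) Θ.open_target,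
    ⟨⟨hx, hx⟩, ?_⟩, ?_, ?_, ?_⟩
  · change j (x, x) ∈ Θ.target
    rw [hjeq (x, x) ⟨hx, hx⟩ rfl]
    exact Θ.map_source hx
  · exact Θ.symm.contMDiffOn.comp (t := Θ.target) (hj.mono Set.inter_subset_left) fun y hy => hy.2
  · intro y hy
    have hy' : Θ.symm (j y) ∈ Θ.source := Θ.map_target hy.2
    apply Ψ.injOn (hfm hy') (hfm hy.1.1)
    have h1 := h _ hy'
    have h2 : Θ (Θ.symm (j y)) = j y := Θ.right_inv hy.2
    rw [h2] at h1
    exact h1.trans (h _ hy.1.1).symm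
  · intro y hy hfy
    change Θ.symm (j y) = y.2
    rw [hjeq y hy.1 hfy]
    exact Θ.left_inv hy.1.2

end Submersion

/-! ### The inverse function theorem -/

section InverseFunction

variable {E : Type*} [NormedAddCommGroup E] [NormedSpace ℝ E] [FiniteDimensional ℝ E]

/-- The inverse function theorem, with an inverse that is smooth on an open set and not only at the
given point. -/
theorem ContDiffOn.exists_partialDiffeomorph {f : E → E} {V : Set E} {a : E}
    (hf : ContDiffOn ℝ ∞ f V) (hV : IsOpen V) (ha : a ∈ V)
    (hinj : Function.Injective (fderiv ℝ f a)) :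
    ∃ Φ : PartialDiffeomorph 𝓘(ℝ, E) 𝓘(ℝ, E) E E ∞,
      a ∈ Φ.source ∧ Φ.source ⊆ V ∧ ∀ y, Φ y = f y := by
  have hn : (∞ : WithTop ℕ∞) ≠ 0 := by simp
  have : CompleteSpace E := FiniteDimensional.complete ℝ E
  have hfa : ∀ y ∈ V, ContDiffAt ℝ ∞ f y := fun y hy => hf.contDiffAt (hV.mem_nhds hy)
  let f' : E ≃L[ℝ] E :=
    (LinearEquiv.ofInjectiveEndo (fderiv ℝ f a).toLinearMap hinj).toContinuousLinearEquiv
  have hf' : HasFDerivAt f (f' : E →L[ℝ] E) a := by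
    have : (f' : E →L[ℝ] E) = fderiv ℝ f a := by ext; rfl
    rw [this]
    exact ((hfa a ha).differentiableAt hn).hasFDerivAt
  -- The inverse is smooth near every point at which the derivative of `f` is invertible.
  have hW : IsOpen (V ∩ fderiv ℝ f ⁻¹' Set.range ((↑) : (E ≃L[ℝ] E) → E →L[ℝ] E)) :=
    (hf.continuousOn_fderiv_of_isOpen hV (by simp)).isOpen_inter_preimage hV
      ContinuousLinearEquiv.isOpen
  let e := ((hfa a ha).toOpenPartialHomeomorph f hf' hn).restrOpen _ hW
  have hes : e.source ⊆ V ∩ fderiv ℝ f ⁻¹' Set.range ((↑) : (E ≃L[ℝ] E) → E →L[ℝ] E) :=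
    fun y hy => hy.2
  refine ⟨{ e with
      contMDiffOn_toFun := ContDiffOn.contMDiffOn (hf.mono fun y hy => (hes hy).1)
      contMDiffOn_invFun := ContDiffOn.contMDiffOn fun z hz => ?_ }, ?_, fun y hy => (hes hy).1,
      fun y => rfl⟩
  · obtain ⟨hzV, g, hg⟩ := hes (e.map_target hz)
    refine ContDiffAt.contDiffWithinAt (e.contDiffAt_symm (f₀' := g) hz ?_ (hfa _ hzV))
    rw [hg]
    exact ((hfa _ hzV).differentiableAt hn).hasFDerivAt
  · exact ⟨(hfa a ha).mem_toOpenPartialHomeomorph_source hf' hn, ha, f', hf'.fderiv.symm⟩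

/-- The inverse function theorem for a smooth map between manifolds of the same dimension. -/
theorem ContMDiffOn.exists_injOn_isLocalDiffeomorphOn {X Y : Type*}
    [TopologicalSpace X] [ChartedSpace E X] [IsManifold 𝓘(ℝ, E) ∞ X]
    [TopologicalSpace Y] [ChartedSpace E Y] [IsManifold 𝓘(ℝ, E) ∞ Y]
    {f : X → Y} {V : Set X} {x : X} (hf : ContMDiffOn 𝓘(ℝ, E) 𝓘(ℝ, E) ∞ f V) (hV : IsOpen V)
    (hx : x ∈ V) (hinj : Function.Injective (mfderiv 𝓘(ℝ, E) 𝓘(ℝ, E) f x)) :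
    ∃ U ⊆ V, IsOpen U ∧ x ∈ U ∧ Set.InjOn f U ∧ IsLocalDiffeomorphOn 𝓘(ℝ, E) 𝓘(ℝ, E) ∞ f U := by
  have hn : (∞ : WithTop ℕ∞) ≠ 0 := by simp
  let φ : PartialDiffeomorph 𝓘(ℝ, E) 𝓘(ℝ, E) X E ∞ :=
    { chartAt E x with
      contMDiffOn_toFun := contMDiffOn_chart
      contMDiffOn_invFun := contMDiffOn_chart_symm }
  let ψ : PartialDiffeomorph 𝓘(ℝ, E) 𝓘(ℝ, E) Y E ∞ :=
    { chartAt E (f x) with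
      contMDiffOn_toFun := contMDiffOn_chart
      contMDiffOn_invFun := contMDiffOn_chart_symm }
  have hxφ : x ∈ φ.source := mem_chart_source E x
  have hxψ : f x ∈ ψ.source := mem_chart_source E (f x)
  have hx' : φ.symm (φ x) = x := φ.left_inv hxφ
  have hVψ : IsOpen (V ∩ f ⁻¹' ψ.source) := hf.continuousOn.isOpen_inter_preimage hV ψ.open_source
  have hV' : IsOpen (φ.target ∩ φ.symm ⁻¹' (V ∩ f ⁻¹' ψ.source)) :=
    φ.symm.contMDiffOn.continuousOn.isOpen_inter_preimage φ.open_target hVψ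
  have hsm : ContMDiffOn 𝓘(ℝ, E) 𝓘(ℝ, E) ∞ (fun u => ψ (f (φ.symm u)))
      (φ.target ∩ φ.symm ⁻¹' (V ∩ f ⁻¹' ψ.source)) :=
    (ψ.contMDiffOn.comp (hf.mono Set.inter_subset_left) fun y hy => hy.2).comp
      (φ.symm.contMDiffOn.mono Set.inter_subset_left) fun u hu => hu.2
  have hd : HasMFDerivAt 𝓘(ℝ, E) 𝓘(ℝ, E) (fun u => ψ (f (φ.symm u))) (φ x)
      ((mfderiv 𝓘(ℝ, E) 𝓘(ℝ, E) ψ (f x) : E →L[ℝ] E).comp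
        ((mfderiv 𝓘(ℝ, E) 𝓘(ℝ, E) f x : E →L[ℝ] E).comp
          (mfderiv 𝓘(ℝ, E) 𝓘(ℝ, E) φ.symm (φ x) : E →L[ℝ] E))) := by
    have d1 := (φ.symm.mdifferentiableAt hn (φ.map_source hxφ)).hasMFDerivAt
    have d2 := ((hf.contMDiffAt (hV.mem_nhds hx)).mdifferentiableAt hn).hasMFDerivAt
    have d3 := (ψ.mdifferentiableAt hn hxψ).hasMFDerivAt
    have d4 := HasMFDerivAt.comp x d3 d2
    rw [← hx'] at d4
    have d5 := HasMFDerivAt.comp (φ x) d4 d1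
    rw [hx'] at d5
    exact d5
  have hψi : Function.Injective (mfderiv 𝓘(ℝ, E) 𝓘(ℝ, E) ψ (f x)) :=
    (IsLocalDiffeomorphAt.mfderivToContinuousLinearEquiv ⟨ψ, hxψ, Set.eqOn_refl _ _⟩ hn).injective
  have hφi : Function.Injective (mfderiv 𝓘(ℝ, E) 𝓘(ℝ, E) φ.symm (φ x)) :=
    (IsLocalDiffeomorphAt.mfderivToContinuousLinearEquiv
      ⟨φ.symm, φ.map_source hxφ, Set.eqOn_refl _ _⟩ hn).injective
  obtain ⟨Φ, hΦx, hΦV, hΦ⟩ := hsm.contDiffOn.exists_partialDiffeomorph hV'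
    (a := φ x) ⟨φ.map_source hxφ, by
      rw [Set.mem_preimage, hx']; exact ⟨hx, hxψ⟩⟩
    (by
      rw [← mfderiv_eq_fderiv, hd.mfderiv]
      exact hψi.comp (hinj.comp hφi))
  let Λ := (φ.trans Φ).trans ψ.symm
  have hΛs : Λ.source = (φ.source ∩ φ ⁻¹' Φ.source) ∩ (fun y => Φ (φ y)) ⁻¹' ψ.target := rfl
  have hmem : ∀ y ∈ φ.source ∩ φ ⁻¹' Φ.source, y ∈ V ∧ f y ∈ ψ.source ∧ Φ (φ y) = ψ (f y) := by
    intro y hy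
    have h1 := (hΦV hy.2).2
    have h2 : φ.symm (φ y) = y := φ.left_inv hy.1
    have h3 := hΦ (φ y)
    rw [Set.mem_preimage, h2] at h1
    rw [h2] at h3
    exact ⟨h1.1, h1.2, h3⟩
  have hΛ : Set.EqOn f Λ Λ.source := by
    intro y hy
    rw [hΛs] at hy
    obtain ⟨-, h2, h3⟩ := hmem y hy.1
    change f y = ψ.symm (Φ (φ y))
    rw [h3]
    exact (ψ.left_inv h2).symm
  refine ⟨Λ.source, fun y hy => (hmem y (hΛs ▸ hy).1).1, Λ.open_source, ?_,
    hΛ.injOn_iff.2 Λ.injOn, fun y => ⟨Λ, y.2, hΛ⟩⟩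
  rw [hΛs]
  refine ⟨⟨hxφ, hΦx⟩, ?_⟩
  change Φ (φ x) ∈ ψ.target
  rw [(hmem x ⟨hxφ, hΦx⟩).2.2]
  exact ψ.map_source hxψ

end InverseFunction

/-! ### Local bisections -/

/-- If `S : V → V` and `T : C → V` are jointly surjective, then `S` becomes injective after adding
a suitable map that factors through `T`. -/
theorem LinearMap.exists_injective_add_comp {K V C : Type*} [Field K] [AddCommGroup V] [Module K V]
    [FiniteDimensional K V] [AddCommGroup C] [Module K C] (S : V →ₗ[K] V) (T : C →ₗ[K] V)
    (h : ∀ v, ∃ u c, S u + T c = v) :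
    ∃ N : V →ₗ[K] C, Function.Injective (S + T ∘ₗ N) := by
  -- A right inverse `k` of `C → V ⧸ range S`; the slope `N` sends `ker S` to `k (V ⧸ range S)`.
  obtain ⟨k, hk⟩ := (S.range.mkQ ∘ₗ T).exists_rightInverse_of_surjective <| by
    rw [LinearMap.range_eq_top]
    intro q
    obtain ⟨v, rfl⟩ := S.range.mkQ_surjective q
    obtain ⟨u, c, rfl⟩ := h v
    refine ⟨c, ?_⟩
    rw [map_add, LinearMap.comp_apply, right_eq_add, ← LinearMap.mem_ker, Submodule.ker_mkQ]
    exact LinearMap.mem_range_self S u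
  have hdim : Module.finrank K S.ker = Module.finrank K (V ⧸ S.range) := by
    have h1 := S.finrank_range_add_finrank_ker
    have h2 := S.range.finrank_quotient_add_finrank
    omega
  let j := LinearEquiv.ofFinrankEq _ _ hdim
  obtain ⟨π, hπ⟩ := S.ker.subtype.exists_leftInverse_of_injective S.ker.ker_subtype
  refine ⟨k ∘ₗ j.toLinearMap ∘ₗ π, ?_⟩
  rw [← LinearMap.ker_eq_bot, LinearMap.ker_eq_bot']
  intro u hu
  have hu' : S u + T (k (j (π u))) = 0 := hu
  have h1 : S.range.mkQ (S u) = 0 := by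
    rw [← LinearMap.mem_ker, Submodule.ker_mkQ]
    exact LinearMap.mem_range_self S u
  have h2 : S.range.mkQ (T (k (j (π u)))) = j (π u) := congrArg (fun f => f (j (π u))) hk
  have h3 : π u = 0 := by
    have h4 := congrArg S.range.mkQ hu'
    rw [map_add, h1, h2, map_zero, zero_add] at h4
    exact j.map_eq_zero_iff.1 h4
  rw [h3, map_zero, map_zero, map_zero, add_zero] at hu'
  have h5 : π u = ⟨u, hu'⟩ := congrArg (fun f => f ⟨u, hu'⟩) hπ
  rw [h3] at h5
  exact (congrArg Subtype.val h5).symm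

namespace LieGroupoid

variable {E₀ E₁ G₀ G : Type*}
    [NormedAddCommGroup E₀] [NormedSpace ℝ E₀] [NormedAddCommGroup E₁] [NormedSpace ℝ E₁]
    [TopologicalSpace G₀] [ChartedSpace E₀ G₀] [TopologicalSpace G] [ChartedSpace E₁ G]

/-- Through every arrow of a Lie groupoid there is a local bisection: among the local sections of
the source map through `g`, one can choose the tangent space at `g` transverse to the kernel of the
derivative of the target map. -/
theorem exists_localBisection [FiniteDimensional ℝ E₀]
    [IsManifold 𝓘(ℝ, E₀) ∞ G₀] [IsManifold 𝓘(ℝ, E₁) ∞ G] (𝓖 : LieGroupoid E₀ E₁ G₀ G) (g : G) :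
    ∃ b : 𝓖.LocalBisection, 𝓖.src g ∈ b.U ∧ b.γ (𝓖.src g) = g := by
  have hn : (∞ : WithTop ℕ∞) ≠ 0 := by simp
  have hs := 𝓖.isSubmersion_src.isSubmersionAt g
  obtain ⟨Θ, Ψ, hg, hsm, h⟩ := hs.exists_product_coordinates
  have ht := (𝓖.isSubmersion_tgt.isSubmersionAt g).mfderiv_surjective
  have hΨi : Function.Injective (mfderiv 𝓘(ℝ, E₀) 𝓘(ℝ, E₀) Ψ (𝓖.src g)) :=
    (IsLocalDiffeomorphAt.mfderivToContinuousLinearEquiv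
      ⟨Ψ, hsm hg, Set.eqOn_refl _ _⟩ hn).injective
  have hΘs : Function.Surjective
      (mfderiv 𝓘(ℝ, E₀ × hs.complement) 𝓘(ℝ, E₁) Θ.symm (Θ g)) :=
    (IsLocalDiffeomorphAt.mfderivToContinuousLinearEquiv
      ⟨Θ.symm, Θ.map_source hg, Set.eqOn_refl _ _⟩ hn).surjective
  have hΘg : Θ.symm (Θ g) = g := Θ.left_inv hg
  -- The derivative of the target map in the product coordinates at `g`.
  let T : E₀ × hs.complement →L[ℝ] E₀ :=
    (mfderiv 𝓘(ℝ, E₁) 𝓘(ℝ, E₀) 𝓖.tgt g : E₁ →L[ℝ] E₀).comp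
      (mfderiv 𝓘(ℝ, E₀ × hs.complement) 𝓘(ℝ, E₁) Θ.symm (Θ g) : E₀ × hs.complement →L[ℝ] E₁)
  obtain ⟨N, hN⟩ := LinearMap.exists_injective_add_comp
    (T.toLinearMap ∘ₗ LinearMap.inl ℝ E₀ hs.complement)
    (T.toLinearMap ∘ₗ LinearMap.inr ℝ E₀ hs.complement) (by
      intro v
      obtain ⟨w, hw⟩ := ht v
      obtain ⟨⟨u, c⟩, hz⟩ := hΘs (w : E₁)
      refine ⟨u, c, ?_⟩
      change T (u, 0) + T (0, c) = v
      rw [← map_add, Prod.mk_add_mk, add_zero, zero_add]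
      exact (congrArg (mfderiv 𝓘(ℝ, E₁) 𝓘(ℝ, E₀) 𝓖.tgt g : E₁ →L[ℝ] E₀) hz).trans hw)
  obtain ⟨U, σ, hU, hgU, hσ, hσg, hσs, hσd⟩ := Θ.exists_section Ψ hg hsm h
    (LinearMap.toContinuousLinearMap N)
  have hd : HasMFDerivAt 𝓘(ℝ, E₀) 𝓘(ℝ, E₀) (𝓖.tgt ∘ σ) (𝓖.src g)
      ((T.comp ((ContinuousLinearMap.id ℝ E₀).prod (LinearMap.toContinuousLinearMap N))).comp
        (mfderiv 𝓘(ℝ, E₀) 𝓘(ℝ, E₀) Ψ (𝓖.src g) : E₀ →L[ℝ] E₀)) := by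
    have d1 := (𝓖.isSubmersion_tgt.contMDiff.contMDiffAt (x := g)).mdifferentiableAt hn
    rw [← hσg] at d1
    have d2 := HasMFDerivAt.comp (𝓖.src g) d1.hasMFDerivAt hσd
    rw [hσg] at d2
    exact d2
  obtain ⟨W, hWU, hW, hgW, hinj, hloc⟩ := ContMDiffOn.exists_injOn_isLocalDiffeomorphOn
    (𝓖.isSubmersion_tgt.contMDiff.comp_contMDiffOn hσ) hU hgU (by
      rw [hd.mfderiv]
      refine Function.Injective.comp (g := fun u => T (u, N u)) ?_ hΨi
      intro u v huv
      apply hN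
      change T (u, 0) + T (0, N u) = T (v, 0) + T (0, N v)
      rw [← map_add, ← map_add]
      simpa using huv)
  exact ⟨⟨W, σ, hW, hσ.mono hWU, fun x hx => hσs x (hWU hx), hinj, hloc⟩, hgW, hσg⟩

end LieGroupoid

/-! ### Velocities of curves -/

section Velocity

variable {E E' X Y : Type*} [NormedAddCommGroup E] [NormedSpace ℝ E]
    [NormedAddCommGroup E'] [NormedSpace ℝ E']
    [TopologicalSpace X] [ChartedSpace E X] [TopologicalSpace Y] [ChartedSpace E' Y]

/-- The curve `c` is differentiable at time `0` with velocity `v`. The velocity is an element of the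
model space, to which every tangent space is definitionally equal. -/
def HasVelocity (c : ℝ → X) (v : E) : Prop :=
  HasMFDerivAt 𝓘(ℝ, ℝ) 𝓘(ℝ, E) c 0 (ContinuousLinearMap.toSpanSingleton ℝ v)

theorem HasVelocity.eq {c c' : ℝ → X} {v w : E} (hc : HasVelocity c v) (hc' : HasVelocity c' w)
    (h : c =ᶠ[nhds 0] c') : v = w := by
  have h1 := congrArg (fun T => T (1 : ℝ)) (hasMFDerivAt_unique hc (hc'.congr_of_eventuallyEq h))
  have h2 : (1 : ℝ) • v = (1 : ℝ) • w := h1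
  simpa using h2

theorem HasMFDerivAt.hasVelocity {c : ℝ → X} {T : ℝ →L[ℝ] E} {v : E}
    (h : HasMFDerivAt 𝓘(ℝ, ℝ) 𝓘(ℝ, E) c 0 T) (hT : T 1 = v) : HasVelocity c v := by
  have h0 : T = ContinuousLinearMap.toSpanSingleton ℝ v := by
    ext
    simpa using hT
  subst h0
  exact h

theorem HasVelocity.const (x : X) : HasVelocity (fun _ => x) (0 : E) :=
  (hasMFDerivAt_const (I := 𝓘(ℝ, ℝ)) (I' := 𝓘(ℝ, E)) x (0 : ℝ)).hasVelocity rfl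

theorem HasVelocity.tendsto {c : ℝ → X} {v : E} {x : X} (hc : HasVelocity c v) (hx : c 0 = x) :
    Filter.Tendsto c (nhds 0) (nhds x) :=
  hx ▸ hc.continuousAt.tendsto

theorem HasMFDerivAt.comp_hasVelocity {H' : Type*} [TopologicalSpace H']
    {J : ModelWithCorners ℝ E' H'} {Y : Type*} [TopologicalSpace Y] [ChartedSpace H' Y]
    {f : Y → X} {y : Y} {L : E' →L[ℝ] E} {c : ℝ → Y} {v : E'} (hf : HasMFDerivAt J 𝓘(ℝ, E) f y L)
    (hc : HasMFDerivAt 𝓘(ℝ, ℝ) J c 0 (ContinuousLinearMap.toSpanSingleton ℝ v)) (hy : c 0 = y) :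
    HasVelocity (f ∘ c) (L v) := by
  subst hy
  exact (HasMFDerivAt.comp (0 : ℝ) hf hc).hasVelocity (congrArg L (one_smul ℝ v))

/-- The chain rule for a map that is differentiable along a subset `S`, and an inner map with values
in `S`. -/
theorem MDifferentiableWithinAt.hasMFDerivAt_comp {E₁ E₂ E₃ H₁ H₂ H₃ X₁ X₂ X₃ : Type*}
    [NormedAddCommGroup E₁] [NormedSpace ℝ E₁] [NormedAddCommGroup E₂] [NormedSpace ℝ E₂]
    [NormedAddCommGroup E₃] [NormedSpace ℝ E₃] [TopologicalSpace H₁] [TopologicalSpace H₂]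
    [TopologicalSpace H₃] {I₁ : ModelWithCorners ℝ E₁ H₁} {I₂ : ModelWithCorners ℝ E₂ H₂}
    {I₃ : ModelWithCorners ℝ E₃ H₃} [TopologicalSpace X₁] [ChartedSpace H₁ X₁]
    [TopologicalSpace X₂] [ChartedSpace H₂ X₂] [TopologicalSpace X₃] [ChartedSpace H₃ X₃]
    {f : X₂ → X₃} {c : X₁ → X₂} {S : Set X₂} {x : X₁} {y : X₂} {L : E₁ →L[ℝ] E₂}
    (hf : MDifferentiableWithinAt I₂ I₃ f S y) (hc : HasMFDerivAt I₁ I₂ c x L) (hy : c x = y)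
    (hS : ∀ᶠ z in nhds x, c z ∈ S) :
    HasMFDerivAt I₁ I₃ (f ∘ c) x ((mfderivWithin I₂ I₃ f S y : E₂ →L[ℝ] E₃).comp L) := by
  subst hy
  exact (hf.hasMFDerivWithinAt.comp x (hc.hasMFDerivWithinAt (s := c ⁻¹' S))
    (Set.Subset.refl _)).hasMFDerivAt hS

theorem MDifferentiableWithinAt.comp_hasVelocity {H' : Type*} [TopologicalSpace H']
    {J : ModelWithCorners ℝ E' H'} {Y : Type*} [TopologicalSpace Y] [ChartedSpace H' Y]
    {f : Y → X} {S : Set Y} {y : Y} {c : ℝ → Y} {v : E'}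
    (hf : MDifferentiableWithinAt J 𝓘(ℝ, E) f S y)
    (hc : HasMFDerivAt 𝓘(ℝ, ℝ) J c 0 (ContinuousLinearMap.toSpanSingleton ℝ v)) (hy : c 0 = y)
    (hS : ∀ᶠ τ in nhds 0, c τ ∈ S) :
    HasVelocity (E := E) (f ∘ c) (mfderivWithin J 𝓘(ℝ, E) f S y v) := by
  exact (hf.hasMFDerivAt_comp hc hy hS).hasVelocity
    (congrArg (mfderivWithin J 𝓘(ℝ, E) f S y : E' →L[ℝ] E) (one_smul ℝ v))

theorem HasVelocity.prodMk {c : ℝ → X} {c' : ℝ → Y} {v : E} {w : E'} (hc : HasVelocity c v)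
    (hc' : HasVelocity c' w) :
    HasMFDerivAt 𝓘(ℝ, ℝ) (𝓘(ℝ, E).prod 𝓘(ℝ, E')) (fun τ => (c τ, c' τ)) 0
      (ContinuousLinearMap.toSpanSingleton ℝ (v, w)) := by
  have h := HasMFDerivAt.prodMk hc hc'
  have h0 : (ContinuousLinearMap.toSpanSingleton ℝ v).prod
    (ContinuousLinearMap.toSpanSingleton ℝ w) =
    ContinuousLinearMap.toSpanSingleton ℝ (v, w) := by ext <;> simp
  exact h0 ▸ h

end Velocity

/-! ### Conjugation by a local bisection -/

namespace LieGroupoid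

variable {E₀ E₁ G₀ G : Type*}
    [NormedAddCommGroup E₀] [NormedSpace ℝ E₀] [NormedAddCommGroup E₁] [NormedSpace ℝ E₁]
    [TopologicalSpace G₀] [ChartedSpace E₀ G₀] [TopologicalSpace G] [ChartedSpace E₁ G]
    {𝓖 : LieGroupoid E₀ E₁ G₀ G}

theorem contMDiffAt_conjInv (b : 𝓖.LocalBisection) {x : G₀} (hx : x ∈ b.U) :
    ContMDiffAt 𝓘(ℝ, E₁) 𝓘(ℝ, E₁) ∞ (𝓖.conjInv b) (𝓖.one x) := by
  have hs := 𝓖.isSubmersion_src.contMDiff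
  have ht := 𝓖.isSubmersion_tgt.contMDiff
  have hO : IsOpen (𝓖.src ⁻¹' b.U ∩ 𝓖.tgt ⁻¹' b.U) :=
    (b.isOpen_U.preimage hs.continuous).inter (b.isOpen_U.preimage ht.continuous)
  have h1 : ContMDiffOn 𝓘(ℝ, E₁) 𝓘(ℝ, E₁) ∞ (fun g => b.γ (𝓖.src g))
      (𝓖.src ⁻¹' b.U ∩ 𝓖.tgt ⁻¹' b.U) :=
    b.contMDiffOn.comp hs.contMDiffOn fun g hg => hg.1
  have h2 : ContMDiffOn 𝓘(ℝ, E₁) 𝓘(ℝ, E₁) ∞ (fun g => b.γ (𝓖.tgt g))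
      (𝓖.src ⁻¹' b.U ∩ 𝓖.tgt ⁻¹' b.U) :=
    b.contMDiffOn.comp ht.contMDiffOn fun g hg => hg.2
  have h3 : ContMDiffOn 𝓘(ℝ, E₁) 𝓘(ℝ, E₁) ∞ (fun g => 𝓖.mul (𝓖.inv (b.γ (𝓖.src g))) g)
      (𝓖.src ⁻¹' b.U ∩ 𝓖.tgt ⁻¹' b.U) :=
    𝓖.contMDiffOn_mul.comp ((𝓖.contMDiff_inv.comp_contMDiffOn h1).prodMk contMDiffOn_id)
      fun g hg => by
        change 𝓖.tgt (𝓖.inv (b.γ (𝓖.src g))) = 𝓖.src g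
        rw [𝓖.tgt_inv, b.src_γ _ hg.1]
  have h4 : ContMDiffOn 𝓘(ℝ, E₁) 𝓘(ℝ, E₁) ∞ (𝓖.conjInv b)
      (𝓖.src ⁻¹' b.U ∩ 𝓖.tgt ⁻¹' b.U) :=
    𝓖.contMDiffOn_mul.comp (h3.prodMk h2) fun g hg => by
      change 𝓖.tgt (𝓖.mul (𝓖.inv (b.γ (𝓖.src g))) g) = 𝓖.src (b.γ (𝓖.tgt g))
      rw [𝓖.tgt_mul _ _ (by rw [𝓖.tgt_inv, b.src_γ _ hg.1]), b.src_γ _ hg.2]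
  refine h4.contMDiffAt (hO.mem_nhds ⟨?_, ?_⟩)
  · rwa [Set.mem_preimage, 𝓖.src_one]
  · rwa [Set.mem_preimage, 𝓖.tgt_one]

end LieGroupoid

namespace PrincipalGroupoidBundle

variable {E₀ E₁ G₀ G : Type*}
    [NormedAddCommGroup E₀] [NormedSpace ℝ E₀] [NormedAddCommGroup E₁] [NormedSpace ℝ E₁]
    [TopologicalSpace G₀] [ChartedSpace E₀ G₀] [TopologicalSpace G] [ChartedSpace E₁ G]
    {𝓖 : LieGroupoid E₀ E₁ G₀ G} {EM EP M P : Type*}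
    [NormedAddCommGroup EM] [NormedSpace ℝ EM] [NormedAddCommGroup EP] [NormedSpace ℝ EP]
    [TopologicalSpace M] [ChartedSpace EM M] [TopologicalSpace P] [ChartedSpace EP P]
    (𝓟 : PrincipalGroupoidBundle 𝓖 EM EP M P)

/-! ### The division map -/

theorem div_act {p : P} {g : G} (h : 𝓟.moment p = 𝓖.src g) : 𝓟.div p (𝓟.act p g) = g := by
  obtain ⟨h1, h2⟩ := 𝓟.div_spec (𝓟.proj_act p g h)
  have := 𝓟.isDiffeoOn.1.injOn (x₁ := (p, 𝓟.div p (𝓟.act p g))) (x₂ := (p, g)) h1 h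
    (by simp [h2])
  exact congrArg Prod.snd this

theorem tgt_div {p q : P} (h : 𝓟.proj q = 𝓟.proj p) : 𝓖.tgt (𝓟.div p q) = 𝓟.moment q := by
  obtain ⟨h1, h2⟩ := 𝓟.div_spec h
  rw [← 𝓟.moment_act _ _ h1, h2]

theorem act_act_inv {p : P} {g : G} (h : 𝓟.moment p = 𝓖.src g) :
    𝓟.act (𝓟.act p g) (𝓖.inv g) = p := by
  rw [← 𝓟.act_mul _ _ _ h (𝓖.src_inv g).symm, 𝓖.mul_inv, ← h, 𝓟.act_one]

theorem contMDiffOn_div :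
    ContMDiffOn (𝓘(ℝ, EP).prod 𝓘(ℝ, EP)) 𝓘(ℝ, E₁) ∞ (fun y : P × P => 𝓟.div y.1 y.2)
      {y | 𝓟.proj y.1 = 𝓟.proj y.2} := by
  obtain ⟨-, -, k, hk, hks⟩ := 𝓟.isDiffeoOn
  refine (contMDiff_snd.comp_contMDiffOn hks).congr fun y hy => ?_
  obtain ⟨h1, h2⟩ := 𝓟.div_spec (p := y.1) (q := y.2) (Eq.symm hy)
  have h3 : k (y.1, 𝓟.act y.1 (𝓟.div y.1 y.2)) = (y.1, 𝓟.div y.1 y.2) :=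
    hk.1 (x := (y.1, 𝓟.div y.1 y.2)) h1
  have h4 : (y.1, 𝓟.act y.1 (𝓟.div y.1 y.2)) = y := by rw [h2]
  rw [h4] at h3
  exact (congrArg Prod.snd h3).symm

theorem contMDiffOn_div_fibre (p : P) :
    ContMDiffOn 𝓘(ℝ, EP) 𝓘(ℝ, E₁) ∞ (𝓟.div p) {q | 𝓟.proj q = 𝓟.proj p} :=
  𝓟.contMDiffOn_div.comp (contMDiff_const.prodMk contMDiff_id).contMDiffOn fun _ hq => Eq.symm hq

section Derivative

variable [IsManifold 𝓘(ℝ, EP) ∞ P] [IsManifold 𝓘(ℝ, EM) ∞ M]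

/-- Curves in a fibre of `π` compute the derivative of the division map. -/
theorem hasVelocity_div {c : ℝ → P} {p : P} {v : TangentSpace 𝓘(ℝ, EP) p} (hv : v ∈ 𝓟.vertical p)
    (hc : HasVelocity (E := EP) c v) (hc0 : c 0 = p) (hcp : ∀ᶠ τ in nhds 0, 𝓟.proj (c τ) = 𝓟.proj p) :
    HasVelocity (E := E₁) (𝓟.div p ∘ c) (𝓟.divDeriv p ⟨v, hv⟩).1 :=
  MDifferentiableWithinAt.comp_hasVelocity
    ((𝓟.contMDiffOn_div_fibre p p rfl).mdifferentiableWithinAt (by simp)) hc hc0 hcp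

theorem exists_curve_of_mem_vertical {p : P} {v : TangentSpace 𝓘(ℝ, EP) p}
    (hv : v ∈ 𝓟.vertical p) :
    ∃ c : ℝ → P, c 0 = p ∧ (∀ᶠ τ in nhds 0, 𝓟.proj (c τ) = 𝓟.proj p) ∧ HasVelocity (E := EP) c v :=
  exists_curve_in_fibre (𝓟.isSubmersion_proj.isSubmersionAt p) v hv

/-- On vertical vectors the anchor condition holds, because `t (δ(p, q)) = ε(q)`. -/
theorem anchor_divDeriv (p : P) (v : 𝓟.vertical p) :
    𝓖.anchor (𝓟.moment p) (𝓟.divDeriv p v) = mfderiv 𝓘(ℝ, EP) 𝓘(ℝ, E₀) 𝓟.moment p v.1 := by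
  obtain ⟨c, hc0, hcp, hc⟩ := 𝓟.exists_curve_of_mem_vertical v.2
  have h1 := 𝓟.hasVelocity_div v.2 hc hc0 hcp
  have h2 := ((𝓖.isSubmersion_tgt.contMDiff (𝓖.one (𝓟.moment p))).mdifferentiableAt
    (by simp)).hasMFDerivAt.comp_hasVelocity h1 (by simp [hc0, 𝓟.div_self])
  have h3 := ((𝓟.contMDiff_moment p).mdifferentiableAt
    (by simp)).hasMFDerivAt.comp_hasVelocity hc hc0
  refine h2.eq h3 ?_
  filter_upwards [hcp] with τ hτ using 𝓟.tgt_div hτ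

/-- The derivative of `δ_p` is injective, because `q = p δ_p(q)` on the fibre through `p`. -/
theorem divDeriv_eq_zero_iff {p : P} {v : 𝓟.vertical p} : 𝓟.divDeriv p v = 0 ↔ v = 0 := by
  refine ⟨fun hv => ?_, fun hv => by rw [hv, map_zero]⟩
  obtain ⟨c, hc0, hcp, hc⟩ := 𝓟.exists_curve_of_mem_vertical v.2
  have h1 := 𝓟.hasVelocity_div v.2 hc hc0 hcp
  have h0 : ((𝓟.divDeriv p ⟨v.1, v.2⟩).1 : E₁) = 0 := congrArg Subtype.val hv
  rw [h0] at h1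
  have hact : MDifferentiableWithinAt (𝓘(ℝ, EP).prod 𝓘(ℝ, E₁)) 𝓘(ℝ, EP)
      (fun x : P × G => 𝓟.act x.1 x.2) 𝓟.composable (p, 𝓖.one (𝓟.moment p)) :=
    (𝓟.contMDiffOn_act (p, 𝓖.one (𝓟.moment p)) (𝓖.src_one _).symm).mdifferentiableWithinAt
      (by simp)
  have h2 := hact.comp_hasVelocity ((HasVelocity.const p).prodMk h1) (by simp [hc0, 𝓟.div_self])
    (by filter_upwards [hcp] with τ hτ using (𝓟.div_spec hτ).1)
  have h3 := h2.eq hc (by filter_upwards [hcp] with τ hτ using (𝓟.div_spec hτ).2)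
  apply Subtype.ext
  exact h3.symm.trans (map_zero _)

end Derivative

/-! ### Right translation by a local bisection -/

variable {𝓟} in
theorem hasMFDerivAt_rightTranslation (b : 𝓖.LocalBisection) {p : P} (hp : 𝓟.moment p ∈ b.U) :
    HasMFDerivAt 𝓘(ℝ, EP) 𝓘(ℝ, EP) (𝓟.rightTranslation b) p
      ((mfderivWithin (𝓘(ℝ, EP).prod 𝓘(ℝ, E₁)) 𝓘(ℝ, EP) (fun x : P × G => 𝓟.act x.1 x.2)
        𝓟.composable (p, b.γ (𝓟.moment p)) : EP × E₁ →L[ℝ] EP).comp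
          ((ContinuousLinearMap.id ℝ EP).prod
            ((mfderiv 𝓘(ℝ, E₀) 𝓘(ℝ, E₁) b.γ (𝓟.moment p) : E₀ →L[ℝ] E₁).comp
              (mfderiv 𝓘(ℝ, EP) 𝓘(ℝ, E₀) 𝓟.moment p : EP →L[ℝ] E₀)))) := by
  have hn : (∞ : WithTop ℕ∞) ≠ 0 := by simp
  have hO : IsOpen (𝓟.moment ⁻¹' b.U) := b.isOpen_U.preimage 𝓟.contMDiff_moment.continuous
  have d1 := HasMFDerivAt.comp p
    ((b.contMDiffOn.contMDiffAt (b.isOpen_U.mem_nhds hp)).mdifferentiableAt hn).hasMFDerivAt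
    ((𝓟.contMDiff_moment p).mdifferentiableAt hn).hasMFDerivAt
  have hact : MDifferentiableWithinAt (𝓘(ℝ, EP).prod 𝓘(ℝ, E₁)) 𝓘(ℝ, EP)
      (fun x : P × G => 𝓟.act x.1 x.2) 𝓟.composable (p, b.γ (𝓟.moment p)) :=
    (𝓟.contMDiffOn_act (p, b.γ (𝓟.moment p)) (b.src_γ _ hp).symm).mdifferentiableWithinAt hn
  exact hact.hasMFDerivAt_comp ((hasMFDerivAt_id p).prodMk d1) rfl
    (by filter_upwards [hO.mem_nhds hp] with q hq using (b.src_γ _ hq).symm)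

variable {𝓟} in
/-- Where `ε_* X = 0`, the derivative of a bisection does not contribute to `(R_γ)_* X`. -/
theorem mfderiv_rightTranslation_eq_tangentAct (b : 𝓖.LocalBisection) {p : P}
    (hp : 𝓟.moment p ∈ b.U) {X : TangentSpace 𝓘(ℝ, EP) p}
    (hX : mfderiv 𝓘(ℝ, EP) 𝓘(ℝ, E₀) 𝓟.moment p X = 0) :
    mfderiv 𝓘(ℝ, EP) 𝓘(ℝ, EP) (𝓟.rightTranslation b) p X =
      𝓟.tangentAct p (b.γ (𝓟.moment p)) X := by
  rw [(hasMFDerivAt_rightTranslation b hp).mfderiv]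
  change mfderivWithin (𝓘(ℝ, EP).prod 𝓘(ℝ, E₁)) 𝓘(ℝ, EP) (fun x : P × G => 𝓟.act x.1 x.2)
    𝓟.composable (p, b.γ (𝓟.moment p))
    ((X : EP), (mfderiv 𝓘(ℝ, E₀) 𝓘(ℝ, E₁) b.γ (𝓟.moment p) : E₀ →L[ℝ] E₁)
      (mfderiv 𝓘(ℝ, EP) 𝓘(ℝ, E₀) 𝓟.moment p X)) = _
  rw [hX, map_zero]
  rfl

theorem proj_rightTranslation (b : 𝓖.LocalBisection) {p : P} (hp : 𝓟.moment p ∈ b.U) :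
    𝓟.proj (𝓟.rightTranslation b p) = 𝓟.proj p :=
  𝓟.proj_act _ _ (b.src_γ _ hp).symm

/-- Right translation covers the identity of `M`. -/
theorem mfderiv_proj_mfderiv_rightTranslation (b : 𝓖.LocalBisection) {p : P}
    (hp : 𝓟.moment p ∈ b.U) (X : TangentSpace 𝓘(ℝ, EP) p) :
    (mfderiv 𝓘(ℝ, EP) 𝓘(ℝ, EM) 𝓟.proj (𝓟.rightTranslation b p)
      (mfderiv 𝓘(ℝ, EP) 𝓘(ℝ, EP) (𝓟.rightTranslation b) p X) : EM) =
    (mfderiv 𝓘(ℝ, EP) 𝓘(ℝ, EM) 𝓟.proj p X : EM) := by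
  have hn : (∞ : WithTop ℕ∞) ≠ 0 := by simp
  have hO : IsOpen (𝓟.moment ⁻¹' b.U) := b.isOpen_U.preimage 𝓟.contMDiff_moment.continuous
  have d1 := HasMFDerivAt.comp p
    ((𝓟.isSubmersion_proj.contMDiff _).mdifferentiableAt hn).hasMFDerivAt
    (hasMFDerivAt_rightTranslation b hp).mdifferentiableAt.hasMFDerivAt
  have d2 := ((𝓟.isSubmersion_proj.contMDiff p).mdifferentiableAt hn).hasMFDerivAt
  have d3 := hasMFDerivAt_unique d1 (d2.congr_of_eventuallyEq
    (by filter_upwards [hO.mem_nhds hp] with q hq using 𝓟.proj_rightTranslation b hq))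
  exact congrArg (fun T => T X) d3

/-- `δ(p γ, q γ) = γ⁻¹ δ(p, q) γ`. -/
theorem div_rightTranslation (b : 𝓖.LocalBisection) {p q : P} (hp : 𝓟.moment p ∈ b.U)
    (hq : 𝓟.moment q ∈ b.U) (h : 𝓟.proj q = 𝓟.proj p) :
    𝓟.div (𝓟.rightTranslation b p) (𝓟.rightTranslation b q) = 𝓖.conjInv b (𝓟.div p q) := by
  obtain ⟨h1, h2⟩ := 𝓟.div_spec h
  have h3 := 𝓟.tgt_div h
  have hγp := b.src_γ _ hp
  have hγq := b.src_γ _ hq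
  unfold LieGroupoid.conjInv
  rw [← h1, h3]
  have k1 : 𝓖.tgt (𝓖.inv (b.γ (𝓟.moment p))) = 𝓖.src (𝓟.div p q) := by rw [𝓖.tgt_inv, hγp, h1]
  have k2 : 𝓖.tgt (𝓖.mul (𝓖.inv (b.γ (𝓟.moment p))) (𝓟.div p q)) =
      𝓖.src (b.γ (𝓟.moment q)) := by rw [𝓖.tgt_mul _ _ k1, h3, hγq]
  have k3 : 𝓟.moment (𝓟.rightTranslation b p) = 𝓖.src (𝓖.inv (b.γ (𝓟.moment p))) := by
    rw [𝓖.src_inv]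
    exact 𝓟.moment_act _ _ hγp.symm
  have k4 : 𝓟.moment (𝓟.rightTranslation b p) =
      𝓖.src (𝓖.mul (𝓖.inv (b.γ (𝓟.moment p))) (𝓟.div p q)) := by rw [𝓖.src_mul _ _ k1, k3]
  have k5 : 𝓟.act (𝓟.rightTranslation b p) (𝓖.inv (b.γ (𝓟.moment p))) = p :=
    𝓟.act_act_inv hγp.symm
  have k6 : 𝓟.rightTranslation b q = 𝓟.act (𝓟.rightTranslation b p)
      (𝓖.mul (𝓖.mul (𝓖.inv (b.γ (𝓟.moment p))) (𝓟.div p q)) (b.γ (𝓟.moment q))) := by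
    rw [𝓟.act_mul _ _ _ k4 k2, 𝓟.act_mul _ _ _ k3 k1, k5, h2]
    rfl
  rw [k6]
  apply 𝓟.div_act
  rw [𝓖.src_mul _ _ k2, ← k4]

theorem mfderiv_rightTranslation_mem_vertical (b : 𝓖.LocalBisection) {p : P}
    (hp : 𝓟.moment p ∈ b.U) {X : TangentSpace 𝓘(ℝ, EP) p} (hX : X ∈ 𝓟.vertical p) :
    (mfderiv 𝓘(ℝ, EP) 𝓘(ℝ, EP) (𝓟.rightTranslation b) p X) ∈
      𝓟.vertical (𝓟.rightTranslation b p) :=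
  (𝓟.mfderiv_proj_mfderiv_rightTranslation b hp X).trans hX

section Derivative

variable [IsManifold 𝓘(ℝ, EP) ∞ P] [IsManifold 𝓘(ℝ, EM) ∞ M]

/-- The derivative of the division map is equivariant on vertical vectors, whatever the horizontal
distribution. -/
theorem divDeriv_mfderiv_rightTranslation (b : 𝓖.LocalBisection) {p : P}
    (hp : 𝓟.moment p ∈ b.U) (v : 𝓟.vertical p) :
    ((𝓟.divDeriv (𝓟.rightTranslation b p)
      ⟨mfderiv 𝓘(ℝ, EP) 𝓘(ℝ, EP) (𝓟.rightTranslation b) p v.1,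
        𝓟.mfderiv_rightTranslation_mem_vertical b hp v.2⟩).1 : E₁) =
    (𝓖.AdInv b (𝓟.moment p) (𝓟.divDeriv p v) : E₁) := by
  have hn : (∞ : WithTop ℕ∞) ≠ 0 := by simp
  have hO : IsOpen (𝓟.moment ⁻¹' b.U) := b.isOpen_U.preimage 𝓟.contMDiff_moment.continuous
  obtain ⟨c, hc0, hcp, hc⟩ := 𝓟.exists_curve_of_mem_vertical v.2
  have hcU : ∀ᶠ τ in nhds 0, 𝓟.moment (c τ) ∈ b.U := hc.tendsto hc0 (hO.mem_nhds hp)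
  have h1 := ((LieGroupoid.contMDiffAt_conjInv b hp).mdifferentiableAt
    hn).hasMFDerivAt.comp_hasVelocity
    (𝓟.hasVelocity_div v.2 hc hc0 hcp) (by simp [hc0, 𝓟.div_self])
  have h2 := ((hasMFDerivAt_rightTranslation b hp).mdifferentiableAt.hasMFDerivAt).comp_hasVelocity
    hc hc0
  have h3 := 𝓟.hasVelocity_div (𝓟.mfderiv_rightTranslation_mem_vertical b hp v.2) h2
    (by simp [hc0]) (by
      filter_upwards [hcp, hcU] with τ h h'
      exact (𝓟.proj_rightTranslation b h').trans (h.trans (𝓟.proj_rightTranslation b hp).symm))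
  refine h3.eq h1 ?_
  filter_upwards [hcp, hcU] with τ h h' using 𝓟.div_rightTranslation b hp h' h

end Derivative

end PrincipalGroupoidBundle

namespace PrincipalGroupoidBundle

variable {E₀ E₁ G₀ G : Type*}
    [NormedAddCommGroup E₀] [NormedSpace ℝ E₀] [NormedAddCommGroup E₁] [NormedSpace ℝ E₁]
    [TopologicalSpace G₀] [ChartedSpace E₀ G₀] [TopologicalSpace G] [ChartedSpace E₁ G]
    {𝓖 : LieGroupoid E₀ E₁ G₀ G} {EM EP M P : Type*}
    [NormedAddCommGroup EM] [NormedSpace ℝ EM] [NormedAddCommGroup EP] [NormedSpace ℝ EP]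
    [TopologicalSpace M] [ChartedSpace EM M] [TopologicalSpace P] [ChartedSpace EP P]
    {𝓟 : PrincipalGroupoidBundle 𝓖 EM EP M P}

/-! ### The anchor condition and equivariance -/

namespace HorizontalDistribution

variable [IsManifold 𝓘(ℝ, EP) ∞ P] (𝓗 : 𝓟.HorizontalDistribution)

theorem sub_ver_mem (p : P) (X : TangentSpace 𝓘(ℝ, EP) p) : X - (𝓗.ver p X).1 ∈ 𝓗.H p := by
  rw [← Submodule.projectionOnto_apply_eq_zero_iff (𝓗.isCompl p), map_sub]
  unfold ver
  rw [Submodule.projectionOnto_apply_left, sub_self]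

theorem ver_eq_zero_iff {p : P} {X : TangentSpace 𝓘(ℝ, EP) p} : 𝓗.ver p X = 0 ↔ X ∈ 𝓗.H p :=
  Submodule.projectionOnto_apply_eq_zero_iff _

theorem ver_of_mem_vertical {p : P} {X : TangentSpace 𝓘(ℝ, EP) p} (hX : X ∈ 𝓟.vertical p) :
    𝓗.ver p X = ⟨X, hX⟩ :=
  Submodule.projectionOnto_apply_left (𝓗.isCompl p) ⟨X, hX⟩

/-- A horizontal vector is determined by its projection to the base. -/
theorem eq_of_mem_of_mfderiv_proj_eq {p : P} {X Y : TangentSpace 𝓘(ℝ, EP) p} (hX : X ∈ 𝓗.H p)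
    (hY : Y ∈ 𝓗.H p)
    (h : mfderiv 𝓘(ℝ, EP) 𝓘(ℝ, EM) 𝓟.proj p X = mfderiv 𝓘(ℝ, EP) 𝓘(ℝ, EM) 𝓟.proj p Y) :
    X = Y := by
  have h1 : X - Y ∈ 𝓟.vertical p := by
    change mfderiv 𝓘(ℝ, EP) 𝓘(ℝ, EM) 𝓟.proj p (X - Y) = 0
    rw [map_sub, h, sub_self]
  exact sub_eq_zero.1 (Submodule.disjoint_def.1 (𝓗.isCompl p).disjoint _ h1
    ((𝓗.H p).sub_mem hX hY))

theorem mfderiv_proj_sub_ver (p : P) (X : TangentSpace 𝓘(ℝ, EP) p) :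
    mfderiv 𝓘(ℝ, EP) 𝓘(ℝ, EM) 𝓟.proj p (X - (𝓗.ver p X).1) =
      mfderiv 𝓘(ℝ, EP) 𝓘(ℝ, EM) 𝓟.proj p X := by
  have h : mfderiv 𝓘(ℝ, EP) 𝓘(ℝ, EM) 𝓟.proj p (𝓗.ver p X).1 = 0 := (𝓗.ver p X).2
  rw [map_sub, h, sub_zero]

variable [IsManifold 𝓘(ℝ, EM) ∞ M]

theorem connectionForm_eq_zero_iff {p : P} {X : TangentSpace 𝓘(ℝ, EP) p} :
    𝓗.connectionForm p X = 0 ↔ X ∈ 𝓗.H p :=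
  (𝓟.divDeriv_eq_zero_iff).trans 𝓗.ver_eq_zero_iff

theorem momentCondition_iff_anchorCondition :
    𝓗.MomentCondition ↔ 𝓟.AnchorCondition 𝓗.connectionForm := by
  refine ⟨fun h p X => ?_, fun h p X hX => ?_⟩
  · have h1 := h p _ (𝓗.sub_ver_mem p X)
    rw [map_sub, sub_eq_zero] at h1
    exact (𝓟.anchor_divDeriv p (𝓗.ver p X)).trans h1.symm
  · rw [← h p X, 𝓗.connectionForm_eq_zero_iff.2 hX, map_zero]

/-- On a horizontal vector, equivariance for a bisection `γ` says that `(R_γ)_*` keeps the vector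
horizontal; on vertical vectors equivariance is automatic. -/
theorem isEquivariant_iff : 𝓟.IsEquivariant 𝓗.connectionForm ↔
    ∀ (b : 𝓖.LocalBisection) (p : P), 𝓟.moment p ∈ b.U → ∀ X ∈ 𝓗.H p,
      mfderiv 𝓘(ℝ, EP) 𝓘(ℝ, EP) (𝓟.rightTranslation b) p X ∈ 𝓗.H (𝓟.rightTranslation b p) := by
  refine ⟨fun h b p hp X hX => ?_, fun h b p hp X => ?_⟩
  · rw [← 𝓗.connectionForm_eq_zero_iff]
    have h1 := h b p hp X
    rw [𝓗.connectionForm_eq_zero_iff.2 hX, map_zero] at h1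
    exact Subtype.ext h1
  · have h1 : 𝓗.connectionForm (𝓟.rightTranslation b p)
        (mfderiv 𝓘(ℝ, EP) 𝓘(ℝ, EP) (𝓟.rightTranslation b) p X) =
        𝓟.divDeriv (𝓟.rightTranslation b p)
          ⟨mfderiv 𝓘(ℝ, EP) 𝓘(ℝ, EP) (𝓟.rightTranslation b) p (𝓗.ver p X).1,
            𝓟.mfderiv_rightTranslation_mem_vertical b hp (𝓗.ver p X).2⟩ := by
      have h2 := 𝓗.connectionForm_eq_zero_iff.2 (h b p hp _ (𝓗.sub_ver_mem p X))
      rw [map_sub, map_sub, sub_eq_zero] at h2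
      rw [h2, connectionForm, LinearMap.comp_apply, 𝓗.ver_of_mem_vertical]
    rw [h1]
    exact 𝓟.divDeriv_mfderiv_rightTranslation b hp (𝓗.ver p X)

theorem isPrincipalConnection_iff [FiniteDimensional ℝ E₀] [IsManifold 𝓘(ℝ, E₀) ∞ G₀]
    [IsManifold 𝓘(ℝ, E₁) ∞ G] :
    𝓗.IsPrincipalConnection ↔
      𝓟.AnchorCondition 𝓗.connectionForm ∧ 𝓟.IsEquivariant 𝓗.connectionForm := by
  rw [← 𝓗.momentCondition_iff_anchorCondition, 𝓗.isEquivariant_iff]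
  refine and_congr_right fun hm => ⟨fun h b p hp X hX => ?_, fun h p g hg => ?_⟩
  · rw [mfderiv_rightTranslation_eq_tangentAct b hp (hm p X hX)]
    change _ ∈ 𝓗.H (𝓟.act p (b.γ (𝓟.moment p)))
    rw [h p _ (b.src_γ _ hp).symm]
    exact Submodule.mem_map_of_mem hX
  · obtain ⟨b, hgU, hgb⟩ := 𝓖.exists_localBisection g
    rw [← hg] at hgU hgb
    subst hgb
    ext Y
    refine ⟨fun hY => ?_, ?_⟩
    · -- The preimage of `Y` is the horizontal vector at `p` with the same projection to `M`.
      obtain ⟨X, hX⟩ := (𝓟.isSubmersion_proj.isSubmersionAt p).mfderiv_surjective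
        (mfderiv 𝓘(ℝ, EP) 𝓘(ℝ, EM) 𝓟.proj (𝓟.rightTranslation b p) Y : EM)
      have hZ := 𝓗.sub_ver_mem p X
      refine ⟨X - (𝓗.ver p X).1, hZ, ?_⟩
      rw [← mfderiv_rightTranslation_eq_tangentAct b hgU (hm p _ hZ)]
      refine 𝓗.eq_of_mem_of_mfderiv_proj_eq (p := 𝓟.rightTranslation b p) (h b p hgU _ hZ) hY ?_
      exact (𝓟.mfderiv_proj_mfderiv_rightTranslation b hgU _).trans
        ((𝓗.mfderiv_proj_sub_ver p X).trans hX)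
    · rintro ⟨X, hX, rfl⟩
      rw [← mfderiv_rightTranslation_eq_tangentAct b hgU (hm p X hX)]
      exact h b p hgU X hX

end HorizontalDistribution

end PrincipalGroupoidBundle

/-! ### Smoothness of the connection form -/

theorem TangentBundle.mk_congr {E X : Type*} [NormedAddCommGroup E] [NormedSpace ℝ E]
    [TopologicalSpace X] [ChartedSpace E X] {x y : X} {v w : E} (h : x = y) (h' : v = w) :
    (⟨x, v⟩ : TangentBundle 𝓘(ℝ, E) X) = ⟨y, w⟩ := by
  subst h h'
  rfl

namespace PrincipalGroupoidBundle

variable {E₀ E₁ G₀ G : Type*}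
    [NormedAddCommGroup E₀] [NormedSpace ℝ E₀] [NormedAddCommGroup E₁] [NormedSpace ℝ E₁]
    [TopologicalSpace G₀] [ChartedSpace E₀ G₀] [TopologicalSpace G] [ChartedSpace E₁ G]
    {𝓖 : LieGroupoid E₀ E₁ G₀ G} {EM EP M P : Type*}
    [NormedAddCommGroup EM] [NormedSpace ℝ EM] [NormedAddCommGroup EP] [NormedSpace ℝ EP]
    [TopologicalSpace M] [ChartedSpace EM M] [TopologicalSpace P] [ChartedSpace EP P]
    {𝓟 : PrincipalGroupoidBundle 𝓖 EM EP M P}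

/-- Near every point, the derivatives of the maps `δ_p` along the fibres extend to a smooth bundle
map, defined on all tangent vectors of `P`. It is the derivative in the second variable of the
smooth map `(p, q) ↦ δ(p, r(p, q))`, where `r(p, ·)` is a retraction onto the fibre through `p`. -/
theorem exists_smooth_extension_divDeriv [IsManifold 𝓘(ℝ, EP) ∞ P] [IsManifold 𝓘(ℝ, EM) ∞ M]
    [IsManifold 𝓘(ℝ, E₁) ∞ G] (𝓟 : PrincipalGroupoidBundle 𝓖 EM EP M P) (p₀ : P) :
    ∃ (U : Set P) (B : ∀ q : P, TangentSpace 𝓘(ℝ, EP) q →L[ℝ]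
        TangentSpace 𝓘(ℝ, E₁) (𝓖.one (𝓟.moment q))),
      IsOpen U ∧ p₀ ∈ U ∧
      ContMDiffOn 𝓘(ℝ, EP).tangent 𝓘(ℝ, E₁).tangent ∞
        (fun v : TangentBundle 𝓘(ℝ, EP) P =>
          (⟨𝓖.one (𝓟.moment v.proj), B v.proj v.snd⟩ : TangentBundle 𝓘(ℝ, E₁) G))
        (Bundle.TotalSpace.proj ⁻¹' U) ∧
      ∀ q ∈ U, ∀ v : 𝓟.vertical q, B q v.1 = (𝓟.divDeriv q v).1 := by
  obtain ⟨W, r, hW, hpW, hr, hrp, hre⟩ :=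
    (𝓟.isSubmersion_proj.isSubmersionAt p₀).exists_fibre_retraction
  let D : P × P → G := fun y => 𝓟.div y.1 (r y)
  have hD : ContMDiffOn (𝓘(ℝ, EP).prod 𝓘(ℝ, EP)) 𝓘(ℝ, E₁) ∞ D W :=
    𝓟.contMDiffOn_div.comp (contMDiffOn_fst.prodMk hr) fun y hy => (hrp y hy).symm
  have hD1 : ∀ q, (q, q) ∈ W → D (q, q) = 𝓖.one (𝓟.moment q) := by
    intro q hq
    change 𝓟.div q (r (q, q)) = _
    rw [hre _ hq rfl, 𝓟.div_self]
  have hU : IsOpen {q : P | (q, q) ∈ W} := hW.preimage (continuous_id.prodMk continuous_id)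
  refine ⟨{q | (q, q) ∈ W},
    fun q => (mfderivWithin (𝓘(ℝ, EP).prod 𝓘(ℝ, EP)) 𝓘(ℝ, E₁) D W (q, q) :
      EP × EP →L[ℝ] E₁).comp (ContinuousLinearMap.inr ℝ EP EP), hU, hpW, ?_, ?_⟩
  · have h1 : ContMDiff 𝓘(ℝ, EP).tangent (𝓘(ℝ, EP).prod 𝓘(ℝ, EP)).tangent ∞
        (fun v : TangentBundle 𝓘(ℝ, EP) P =>
          (equivTangentBundleProd 𝓘(ℝ, EP) P 𝓘(ℝ, EP) P).symm
            (Bundle.zeroSection EP (TangentSpace 𝓘(ℝ, EP)) v.proj, v)) :=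
      contMDiff_equivTangentBundleProd_symm.comp
        (((Bundle.contMDiff_zeroSection ℝ (TangentSpace 𝓘(ℝ, EP))).comp
          (Bundle.contMDiff_proj (TangentSpace 𝓘(ℝ, EP)))).prodMk contMDiff_id)
    have h2 := (hD.contMDiffOn_tangentMapWithin (m := ∞) (by simp) hW.uniqueMDiffOn).comp
      (s := Bundle.TotalSpace.proj ⁻¹' {q : P | (q, q) ∈ W}) h1.contMDiffOn fun v hv => hv
    refine h2.congr fun v hv => ?_
    exact TangentBundle.mk_congr (hD1 _ hv).symm rfl
  · intro q hq v
    obtain ⟨c, hc0, hcp, hc⟩ := 𝓟.exists_curve_of_mem_vertical v.2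
    have h1 := 𝓟.hasVelocity_div v.2 hc hc0 hcp
    have hcW : ∀ᶠ τ in nhds 0, (q, c τ) ∈ W := by
      have h2 : Filter.Tendsto (fun τ => (q, c τ)) (nhds 0) (nhds (q, q)) :=
        tendsto_const_nhds.prodMk_nhds (hc.tendsto hc0)
      exact h2 (hW.mem_nhds hq)
    have h3 := ((hD _ hq).mdifferentiableWithinAt (by simp)).comp_hasVelocity
      ((HasVelocity.const q).prodMk hc) (by simp [hc0]) hcW
    refine h3.eq h1 ?_
    filter_upwards [hcp, hcW] with τ hτ hτW
    change 𝓟.div q (r (q, c τ)) = 𝓟.div q (c τ)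
    rw [hre _ hτW hτ]

namespace HorizontalDistribution

/-- The projection onto the vertical bundle along `H` is smooth. In terms of a local frame `X i` of
`H`, it is `v ↦ v - ∑ i, c i v • X i`, where the coefficients `c i v` are found by applying the
inverse of the matrix of the vectors `π_* (X i)` to `π_* v`. -/
theorem contMDiff_ver [FiniteDimensional ℝ EM] [IsManifold 𝓘(ℝ, EP) ∞ P]
    [IsManifold 𝓘(ℝ, EM) ∞ M] (𝓗 : 𝓟.HorizontalDistribution) :
    ContMDiff 𝓘(ℝ, EP).tangent 𝓘(ℝ, EP).tangent ∞
      (fun v : TangentBundle 𝓘(ℝ, EP) P =>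
        (⟨v.proj, (𝓗.ver v.proj v.snd).1⟩ : TangentBundle 𝓘(ℝ, EP) P)) := by
  intro v₀
  obtain ⟨U, k, X, hU, hpU, hX, hXU⟩ := 𝓗.isSmoothSubbundle v₀.proj
  have hproj : ContMDiffAt 𝓘(ℝ, EP).tangent 𝓘(ℝ, EP) ∞
      (fun v : TangentBundle 𝓘(ℝ, EP) P => v.proj) v₀ :=
    (Bundle.contMDiff_proj (TangentSpace 𝓘(ℝ, EP))).contMDiffAt
  have hXat : ∀ i, ContMDiffAt 𝓘(ℝ, EP) 𝓘(ℝ, EP).tangent ∞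
      (fun q => (⟨q, X i q⟩ : TangentBundle 𝓘(ℝ, EP) P)) v₀.proj :=
    fun i => (hX i).contMDiffAt (hU.mem_nhds hpU)
  -- Differentials of `π`, read in a trivialization of the tangent bundle of `M`.
  let e := trivializationAt EM (TangentSpace 𝓘(ℝ, EM)) (𝓟.proj v₀.proj)
  have hπ : Continuous 𝓟.proj := 𝓟.isSubmersion_proj.contMDiff.continuous
  have he : IsOpen (𝓟.proj ⁻¹' e.baseSet) := e.open_baseSet.preimage hπ
  have hpe : v₀.proj ∈ 𝓟.proj ⁻¹' e.baseSet :=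
    FiberBundle.mem_baseSet_trivializationAt EM (TangentSpace 𝓘(ℝ, EM))
      (𝓟.proj v₀.proj)
  let μ : ∀ q : P, TangentSpace 𝓘(ℝ, EP) q →L[ℝ] EM := fun q =>
    (e.continuousLinearMapAt ℝ (𝓟.proj q)).comp (mfderiv 𝓘(ℝ, EP) 𝓘(ℝ, EM) 𝓟.proj q)
  have hμ_apply : ∀ q ∈ 𝓟.proj ⁻¹' e.baseSet, ∀ v,
      μ q v = (e ⟨𝓟.proj q, mfderiv 𝓘(ℝ, EP) 𝓘(ℝ, EM) 𝓟.proj q v⟩).2 := fun q hq _ =>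
    congrFun (e.coe_linearMapAt_of_mem (R := ℝ) (b := 𝓟.proj q) hq) _
  have hμ : ∀ w : TangentBundle 𝓘(ℝ, EP) P, w.proj = v₀.proj →
      ContMDiffAt 𝓘(ℝ, EP).tangent 𝓘(ℝ, EM) ∞
        (fun v : TangentBundle 𝓘(ℝ, EP) P => μ v.proj v.snd) w := by
    intro w hw
    have h1 : ContMDiffAt 𝓘(ℝ, EP).tangent 𝓘(ℝ, EM).tangent ∞
        (tangentMap 𝓘(ℝ, EP) 𝓘(ℝ, EM) 𝓟.proj) w :=
      (𝓟.isSubmersion_proj.contMDiff.contMDiff_tangentMap (by simp)).contMDiffAt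
    have h2 := (Bundle.contMDiffAt_totalSpace.1 h1).2
    have h3 : (tangentMap 𝓘(ℝ, EP) 𝓘(ℝ, EM) 𝓟.proj w).proj = 𝓟.proj v₀.proj :=
      congrArg 𝓟.proj hw
    rw [h3] at h2
    refine h2.congr_of_eventuallyEq ?_
    have h4 : ∀ᶠ v : TangentBundle 𝓘(ℝ, EP) P in nhds w, v.proj ∈ 𝓟.proj ⁻¹' e.baseSet :=
      (FiberBundle.continuous_proj EP (TangentSpace 𝓘(ℝ, EP))).continuousAt
        (he.mem_nhds (hw ▸ hpe))
    filter_upwards [h4] with v hv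
    exact hμ_apply _ hv _
  have hμe : ∀ q ∈ 𝓟.proj ⁻¹' e.baseSet, ∀ v w, μ q v = μ q w →
      mfderiv 𝓘(ℝ, EP) 𝓘(ℝ, EM) 𝓟.proj q v = mfderiv 𝓘(ℝ, EP) 𝓘(ℝ, EM) 𝓟.proj q w := by
    intro q hq v w h
    exact (e.continuousLinearEquivAt ℝ _ hq).injective
      ((hμ_apply q hq v).symm.trans (h.trans (hμ_apply q hq w)))
  have hμs : ∀ q ∈ 𝓟.proj ⁻¹' e.baseSet, Function.Surjective (μ q) := by
    intro q hq y
    obtain ⟨u, hu⟩ := (e.continuousLinearEquivAt ℝ _ hq).surjective y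
    obtain ⟨v, hv⟩ := (𝓟.isSubmersion_proj.isSubmersionAt q).mfderiv_surjective u
    refine ⟨v, ?_⟩
    rw [← hu, ← hv]
    exact hμ_apply q hq v
  let A : P → (Fin k → ℝ) →L[ℝ] EM := fun q =>
    ∑ i, (ContinuousLinearMap.proj i : (Fin k → ℝ) →L[ℝ] ℝ).smulRight (μ q (X i q))
  have hAμ : ∀ q a, A q a = μ q (∑ i, a i • X i q) := by
    intro q a
    simp [A, map_sum]
  have hA : ContMDiffAt 𝓘(ℝ, EP) 𝓘(ℝ, (Fin k → ℝ) →L[ℝ] EM) ∞ A v₀.proj := by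
    have h1 : ContMDiffAt 𝓘(ℝ, EP) 𝓘(ℝ, Fin k → EM) ∞ (fun q i => μ q (X i q)) v₀.proj :=
      contMDiffAt_pi_space.2 fun i => (hμ ⟨v₀.proj, X i v₀.proj⟩ rfl).comp v₀.proj (hXat i)
    have h2 : ContDiff ℝ ∞ (fun w : Fin k → EM =>
        ∑ i, (ContinuousLinearMap.proj i : (Fin k → ℝ) →L[ℝ] ℝ).smulRight (w i)) := by
      fun_prop
    exact h2.contMDiff.contMDiffAt.comp v₀.proj h1
  have hspan : ∀ q ∈ U, ∀ a : Fin k → ℝ, ∑ i, a i • X i q ∈ 𝓗.H q := by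
    intro q hq a
    rw [← (hXU q hq).2]
    exact Submodule.sum_mem _ fun i _ =>
      Submodule.smul_mem _ _ (Submodule.subset_span (Set.mem_range_self i))
  have hAinv : ∀ q ∈ U ∩ 𝓟.proj ⁻¹' e.baseSet, (A q).IsInvertible := by
    intro q hq
    have hinj : Function.Injective (A q) := by
      rw [injective_iff_map_eq_zero]
      intro a ha
      rw [hAμ, ← map_zero (μ q)] at ha
      have h1 := 𝓗.eq_of_mem_of_mfderiv_proj_eq (hspan q hq.1 a) (𝓗.H q).zero_mem
        (hμe q hq.2 _ _ ha)
      exact funext (Fintype.linearIndependent_iff.1 (hXU q hq.1).1 a h1)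
    have hsurj : Function.Surjective (A q) := by
      intro y
      obtain ⟨v, rfl⟩ := hμs q hq.2 y
      have h1 := 𝓗.sub_ver_mem q v
      rw [← (hXU q hq.1).2, Submodule.mem_span_range_iff_exists_fun] at h1
      obtain ⟨a, ha⟩ := h1
      refine ⟨a, ?_⟩
      rw [hAμ, ha]
      exact congrArg (e.continuousLinearMapAt ℝ (𝓟.proj q)) (𝓗.mfderiv_proj_sub_ver q v)
    exact ⟨(LinearEquiv.ofBijective (A q).toLinearMap ⟨hinj, hsurj⟩).toContinuousLinearEquiv,
      by ext; rfl⟩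
  let c : TangentBundle 𝓘(ℝ, EP) P → Fin k → ℝ := fun v =>
    (A v.proj).inverse (μ v.proj v.snd)
  have hc : ContMDiffAt 𝓘(ℝ, EP).tangent 𝓘(ℝ, Fin k → ℝ) ∞ c v₀ := by
    have h1 : ContMDiffAt 𝓘(ℝ, EP).tangent 𝓘(ℝ, EM →L[ℝ] (Fin k → ℝ)) ∞
        (fun v : TangentBundle 𝓘(ℝ, EP) P => (A v.proj).inverse) v₀ :=
      (hAinv _ ⟨hpU, hpe⟩).contDiffAt_map_inverse.contMDiffAt.comp v₀ (hA.comp v₀ hproj)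
    exact h1.clm_apply (hμ v₀ rfl)
  have hver : ∀ v : TangentBundle 𝓘(ℝ, EP) P, v.proj ∈ U ∩ 𝓟.proj ⁻¹' e.baseSet →
      (𝓗.ver v.proj v.snd).1 = v.snd - ∑ i, c v i • X i v.proj := by
    intro v hv
    have h1 : μ v.proj (∑ i, c v i • X i v.proj) = μ v.proj (v.snd - (𝓗.ver v.proj v.snd).1) := by
      rw [← hAμ, ContinuousLinearMap.IsInvertible.self_apply_inverse (hAinv _ hv)]
      exact congrArg (e.continuousLinearMapAt ℝ (𝓟.proj v.proj))
        (𝓗.mfderiv_proj_sub_ver v.proj v.snd).symm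
    have h2 := 𝓗.eq_of_mem_of_mfderiv_proj_eq (hspan _ hv.1 _) (𝓗.sub_ver_mem _ _)
      (hμe _ hv.2 _ _ h1)
    rw [h2, sub_sub_cancel]
  let t := trivializationAt EP (TangentSpace 𝓘(ℝ, EP)) v₀.proj
  have ht0 : v₀.proj ∈ t.baseSet :=
    FiberBundle.mem_baseSet_trivializationAt EP (TangentSpace 𝓘(ℝ, EP)) _
  refine Bundle.contMDiffAt_totalSpace.2 ⟨hproj, ?_⟩
  have hsm : ContMDiffAt 𝓘(ℝ, EP).tangent 𝓘(ℝ, EP) ∞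
      (fun v : TangentBundle 𝓘(ℝ, EP) P =>
        (t v).2 - ∑ i, c v i • (t ⟨v.proj, X i v.proj⟩).2) v₀ := by
    have h1 := (Bundle.contMDiffAt_totalSpace.1 (contMDiffAt_id (I := 𝓘(ℝ, EP).tangent) (n := ∞)
      (x := v₀))).2
    have h2 : ∀ i, ContMDiffAt 𝓘(ℝ, EP).tangent 𝓘(ℝ, EP) ∞
        (fun v : TangentBundle 𝓘(ℝ, EP) P => (t ⟨v.proj, X i v.proj⟩).2) v₀ := fun i =>
      (Bundle.contMDiffAt_totalSpace.1 (hXat i)).2.comp v₀ hproj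
    refine h1.sub (ContMDiffAt.sum fun i _ => ?_)
    exact (contMDiffAt_pi_space.1 hc i).smul (h2 i)
  refine hsm.congr_of_eventuallyEq ?_
  have hev : ∀ᶠ v : TangentBundle 𝓘(ℝ, EP) P in nhds v₀,
      v.proj ∈ (U ∩ 𝓟.proj ⁻¹' e.baseSet) ∩ t.baseSet :=
    (FiberBundle.continuous_proj EP (TangentSpace 𝓘(ℝ, EP))).continuousAt
      (((hU.inter he).inter t.open_baseSet).mem_nhds ⟨⟨hpU, hpe⟩, ht0⟩)
  filter_upwards [hev] with v hv
  have h1 : ∀ w : TangentSpace 𝓘(ℝ, EP) v.proj,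
      (t ⟨v.proj, w⟩).2 = t.continuousLinearMapAt ℝ v.proj w := fun w =>
    (congrFun (t.coe_linearMapAt_of_mem (R := ℝ) (b := v.proj) hv.2) w).symm
  change (t ⟨v.proj, (𝓗.ver v.proj v.snd).1⟩).2 =
    (t ⟨v.proj, v.snd⟩).2 - ∑ i, c v i • (t ⟨v.proj, X i v.proj⟩).2
  simp only [h1]
  rw [hver v hv.1, map_sub, map_sum]
  simp only [map_smul]

theorem isSmoothBundleMap_connectionForm [FiniteDimensional ℝ EM] [IsManifold 𝓘(ℝ, EP) ∞ P]
    [IsManifold 𝓘(ℝ, EM) ∞ M] [IsManifold 𝓘(ℝ, E₁) ∞ G] (𝓗 : 𝓟.HorizontalDistribution) :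
    𝓟.IsSmoothBundleMap 𝓗.connectionForm := by
  intro v₀
  obtain ⟨U, B, hU, hpU, hB, hBv⟩ := 𝓟.exists_smooth_extension_divDeriv v₀.proj
  have hO : IsOpen (Bundle.TotalSpace.proj ⁻¹' U : Set (TangentBundle 𝓘(ℝ, EP) P)) :=
    hU.preimage (FiberBundle.continuous_proj EP (TangentSpace 𝓘(ℝ, EP)))
  have h := hB.comp (s := Bundle.TotalSpace.proj ⁻¹' U) 𝓗.contMDiff_ver.contMDiffOn
    fun v hv => hv
  refine (h.congr fun v hv => ?_).contMDiffAt (hO.mem_nhds hpU)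
  exact TangentBundle.mk_congr rfl (hBv _ hv _).symm

end HorizontalDistribution

end PrincipalGroupoidBundle

theorem mainTheorem5 {E₀ E₁ G₀ G EM EP M P : Type*}
    [NormedAddCommGroup E₀] [NormedSpace ℝ E₀] [FiniteDimensional ℝ E₀]
    [NormedAddCommGroup E₁] [NormedSpace ℝ E₁] [FiniteDimensional ℝ E₁]
    [NormedAddCommGroup EM] [NormedSpace ℝ EM] [FiniteDimensional ℝ EM]
    [NormedAddCommGroup EP] [NormedSpace ℝ EP] [FiniteDimensional ℝ EP]
    [TopologicalSpace G₀] [ChartedSpace E₀ G₀] [IsManifold 𝓘(ℝ, E₀) ∞ G₀]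
    [TopologicalSpace G] [ChartedSpace E₁ G] [IsManifold 𝓘(ℝ, E₁) ∞ G]
    [TopologicalSpace M] [ChartedSpace EM M] [IsManifold 𝓘(ℝ, EM) ∞ M]
    [TopologicalSpace P] [ChartedSpace EP P] [IsManifold 𝓘(ℝ, EP) ∞ P]
    (𝓖 : LieGroupoid E₀ E₁ G₀ G) (𝓟 : PrincipalGroupoidBundle 𝓖 EM EP M P)
    (𝓗 : 𝓟.HorizontalDistribution) :
    𝓟.IsSmoothBundleMap 𝓗.connectionForm ∧
    (𝓗.MomentCondition ↔ 𝓟.AnchorCondition 𝓗.connectionForm) ∧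
    (𝓗.IsPrincipalConnection ↔
      𝓟.AnchorCondition 𝓗.connectionForm ∧ 𝓟.IsEquivariant 𝓗.connectionForm) :=
  ⟨𝓗.isSmoothBundleMap_connectionForm, 𝓗.momentCondition_iff_anchorCondition,
    𝓗.isPrincipalConnection_iff⟩
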